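/- Let $q\in\mathbb C^*$ be not a root of unity, $2s\in\mathbb Z_{\ge0}$, and let $\mathsf b,\mathsf c,\mathsf b^*,\mathsf c^*,\zeta\in\mathbb C^*$ with $\mathsf b\mathsf c=\mathsf b^*\mathsf c^*$. Write $b(x)=x-x^{-1}$, $[X,Y]_q=qXY-q^{-1}YX$, $\theta_M=\mathsf b q^{2M}+\mathsf c q^{-2M}$, $\theta^*_N=\mathsf b^*q^{2N}+\mathsf c^*q^{-2N}$, $\sigma=\mathsf bq^{2s}+\mathsf cq^{-2s}$, $\sigma^*=\mathsf b^*q^{2s}+\mathsf c^*q^{-2s}$, $z=\zeta^2+\zeta^{-2}$, $Q=q^{2s+1}+q^{-2s-1}$, and $$\rho=-\mathsf b\mathsf c(q^2-q^{-2})^2,\qquad \omega=(q-q^{-1})^2(\mathsf b\mathsf c\,zQ-\sigma\sigma^*),$$ $$\eta=-\tfrac{(q^2-q^{-2})^2}{q+q^{-1}}\mathsf b\mathsf c(\sigma z-\sigma^*Q),\qquad \eta^*=-\tfrac{(q^2-q^{-2})^2}{q+q^{-1}}\mathsf b^*\mathsf c^*(\sigma^* z-\sigma Q).$$ The Askey–Wilson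 algebra AW is the unital $\mathbb C$-algebra generated by $\mathsf A,\mathsf A^*$ with relations $$[\mathsf A,[\mathsf A,\mathsf A^*]_q]_{q^{-1}}=\rho\mathsf A^*+\omega\mathsf A+\eta,\qquad [\mathsf A^*,[\mathsf A^*,\mathsf A]_q]_{q^{-1}}=\rho\mathsf A+\omega\mathsf A^*+\eta^*.$$ Let $\pi:\mathrm{AW}\to\mathrm{End}(\mathcal V)$ be an irreducible representation with $\dim\mathcal V=2s+1$ such that $\pi(\mathsf A)$ and $\pi(\mathsf A^*)$ are diagonalizable with pairwise distinct eigenvalues $\theta_0,\dots,\theta_{2s}$ and pairwise distinct eigenvalues $\theta_0^*,\dots,\theta^*_{2s}$ respectively. Let $|\theta_M\rangle$ and $|\theta^*_N\rangle$ be any eigenbases, $\pi(\mathsf A)|\theta_M\rangle=\theta_M|\theta_M\rangle$, $\pi(\mathsf A^*)|\theta^*_N\rangle=\theta^*_N|\theta^*_N\rangle$, let $A^*_{k,k-1}$ be the coefficient of $|\theta_k\rangle$ in $\pi(\mathsf A^*)|\theta_{k-1}\rangle$, and let $A_{k,k-1}$ be the coefficient of $|\theta^*_k\rangle$ in $\pi(\mathsf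 A)|\theta^*_{k-1}\rangle$. *Bethe states.* Fix $\chi\in\mathbb C^*$, $m_0\in\mathbb Z$. Let $\bar\eta(u)=(q+q^{-1})\rho^{-1}(\eta u+\eta^*u^{-1})$ and $$\mathcal A(u)=b(u^2)(qu\mathsf A-q^{-1}u^{-1}\mathsf A^*)-\bar\eta(u),\qquad \mathcal D(u)=b(u^2)(qu\mathsf A^*-q^{-1}u^{-1}\mathsf A)-\bar\eta(u^{-1}),$$ $$\mathcal B(u)=\chi b(u^2)\Big(\rho^{-1}\big([\mathsf A^*,\mathsf A]_q+\tfrac{\omega}{q-q^{-1}}\big)+\tfrac{qu^2+q^{-1}u^{-2}}{q^2-q^{-2}}\Big),$$ $$\mathcal C(u)=\rho\chi^{-1} b(u^2)\Big(\rho^{-1}\big([\mathsf A,\mathsf A^*]_q+\tfrac{\omega}{q-q^{-1}}\big)+\tfrac{qu^2+q^{-1}u^{-2}}{q^2-q^{-2}}\Big).$$ For $\epsilon=\pm1$ put $\gamma^\epsilon(u,m)=\alpha^{\frac{1-\epsilon}2}\beta^{\frac{1+\epsilon}2}q^{-m}u-\alpha^{\frac{1+\epsilon}2}\beta^{\frac{1-\epsilon}2}q^{m}u^{-1}$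 and $$\mathscr B^\epsilon(u,m)=\frac{-\epsilon(qu)^{-\epsilon}}{\gamma^\epsilon(1,m+1)}\Big(\mathcal B(u)+\beta q^{-\epsilon m}u^{-\epsilon}\mathcal A(u)-\beta q^{-\epsilon m}u^{\epsilon}\mathcal D(u)-\beta^2q^{-2\epsilon m}\mathcal C(u)\Big).$$ Define, with $\beta=0$ in both cases, $$|\Psi^M_-(\bar u,m_0)\rangle=\pi\big(\mathscr B^-(u_1,m_0+2(M-1))\cdots\mathscr B^-(u_M,m_0)\big)|\theta_0\rangle,\qquad (q^2-q^{-2})\chi^{-1}\alpha\,\mathsf b\,q^{-m_0}=-1,$$ $$|\Psi^N_+(\bar w,m_0)\rangle=\pi\big(\mathscr B^+(w_1,m_0+2(N-1))\cdots\mathscr B^+(w_N,m_0)\big)|\theta^*_0\rangle,\qquad (q^2-q^{-2})\chi^{-1}\alpha\,\mathsf c^*q^{m_0}=1.$$ *Bethe equations.* Let $$f(u,v)=\frac{b(qv/u)b(uv)}{b(v/u)b(quv)},\qquad h(u,v)=\frac{b(q^2uv)b(qu/v)}{b(quv)b(u/v)},$$ $$\Lambda_1^\epsilon(u)=\tfrac{q^{-2s-1}}{u^\epsilon}(q^{2s+1}u\zeta^{-1}-u^{-1}\zeta)(q^{2s+1}u\zeta-u^{-1}\zeta^{-1})(u\mathsf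 c^*q^{-2s}+u^{-1}\mathsf bq^{2s})\Big(u\big(\tfrac{\mathsf c}{\mathsf c^*}\big)^{\frac{1-\epsilon}2}+u^{-1}\big(\tfrac{\mathsf b^*}{\mathsf b}\big)^{\frac{1+\epsilon}2}\Big),$$ $$\Lambda_2^\epsilon(u)=\tfrac{b(u^2)q^{-2s-1}}{u^\epsilon b(qu^2)}(q^{2s-1}u^{-1}\zeta-u\zeta^{-1})(q^{2s-1}u^{-1}\zeta^{-1}-u\zeta)(q^2u\mathsf bq^{2s}+u^{-1}\mathsf c^*q^{-2s})\Big(q^2u\big(\tfrac{\mathsf b^*}{\mathsf b}\big)^{\frac{1+\epsilon}2}+u^{-1}\big(\tfrac{\mathsf c}{\mathsf c^*}\big)^{\frac{1-\epsilon}2}\Big),$$ $$E^M_\pm(u_i,\bar u_i)=-\frac{b(u_i^2)}{b(qu_i^2)}\prod_{j\ne i}f(u_i,u_j)\,\Lambda_1^\pm(u_i)+\prod_{j\neq i}h(u_i,u_j)\,\Lambda_2^\pm(u_i).$$ A tuple $\bar u=(u_1,\dots,u_M)$ of nonzero complex numbers with $b(qu_i^2)\ne0$ for all $i$ is a *non-trivial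 admissible solution* of the homogeneous Bethe equations $E^M_\pm=0$ if $E_\pm^M(u_i,\bar u_i)=0$ and $u_i^2\ne u_i^{-2}$ for all $i$, and $U_i\neq U_j$ for $i\ne j$, where $U_i=(qu_i^2+q^{-1}u_i^{-2})/(q+q^{-1})$. **Claim.** For all $0\le M,N\le 2s$: for every non-trivial admissible solution $\bar u=(u_1,\dots,u_M)$ of $E^M_-=0$, $$|\theta_M\rangle=\mathcal N_M(\bar u)\,|\Psi^M_-(\bar u,m_0)\rangle,\qquad \mathcal N_M(\bar u)=\prod_{k=1}^M\big(q\,u_k\,b(u_k^2)\,A^*_{k,k-1}\big)^{-1},$$ and for every non-trivial admissible solution $\bar w=(w_1,\dots,w_N)$ of $E^N_+=0$, $$|\theta^*_N\rangle=\mathcal N^*_N(\bar w)\,|\Psi^N_+(\bar w,m_0)\rangle,\qquad \mathcal N^*_N(\bar w)=\prod_{k=1}^N\big(-q^{-1}w_k^{-1}b(w_k^2)\,A_{k,k-1}\big)^{-1}$$ (empty products are $1$). -/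

import Mathlib

noncomputable section

namespace QRacahBethe

/-- The scalar parameters: `n = 2s`, the deformation parameter `q`, the coefficients of the
eigenvalue sequences `θ_M = b q^{2M} + c q^{-2M}` and `θ*_N = b* q^{2N} + c* q^{-2N}`, and `ζ`. -/
structure Params where
  n : ℕ
  q : ℂ
  b : ℂ
  c : ℂ
  bs : ℂ
  cs : ℂ
  zeta : ℂ

/-- `b(x) = x - x⁻¹`. -/
def bf (x : ℂ) : ℂ := x - x⁻¹

namespace Params

variable (p : Params)

/-- The standing assumptions on the parameters: everything is nonzero, `q` is not a root of
unity, and `b c = b* c*` (the two expressions of the structure constant `ρ` agree). -/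
structure Admissible : Prop where
  q_ne_zero : p.q ≠ 0
  q_not_root : ∀ k : ℕ, 0 < k → p.q ^ k ≠ 1
  b_ne_zero : p.b ≠ 0
  c_ne_zero : p.c ≠ 0
  bs_ne_zero : p.bs ≠ 0
  cs_ne_zero : p.cs ≠ 0
  zeta_ne_zero : p.zeta ≠ 0
  bc_eq : p.b * p.c = p.bs * p.cs

/-- `θ_M`. -/
def theta (M : ℕ) : ℂ := p.b * p.q ^ (2 * M) + p.c * p.q ^ (-(2 * M : ℤ))

/-- `θ*_N`. -/
def thetaStar (N : ℕ) : ℂ := p.bs * p.q ^ (2 * N) + p.cs * p.q ^ (-(2 * N : ℤ))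

/-- `ρ = - b c (q² - q⁻²)²`. -/
def rho : ℂ := -(p.b * p.c) * (p.q ^ 2 - p.q ^ (-2 : ℤ)) ^ 2

/-- `b q^{2s} + c q^{-2s}`. -/
def sig : ℂ := p.b * p.q ^ p.n + p.c * p.q ^ (-(p.n : ℤ))

/-- `b* q^{2s} + c* q^{-2s}`. -/
def sigStar : ℂ := p.bs * p.q ^ p.n + p.cs * p.q ^ (-(p.n : ℤ))

/-- `ζ² + ζ⁻²`. -/
def zz : ℂ := p.zeta ^ 2 + p.zeta ^ (-2 : ℤ)

/-- `q^{2s+1} + q^{-2s-1}`. -/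
def qq : ℂ := p.q ^ (p.n + 1) + p.q ^ (-(p.n : ℤ) - 1)

/-- The structure constant `ω`. -/
def omega : ℂ :=
  (p.q - p.q⁻¹) ^ 2 * (p.b * p.c * p.zz * p.qq - p.sig * p.sigStar)

/-- The structure constant `η`. -/
def eta : ℂ :=
  -((p.q ^ 2 - p.q ^ (-2 : ℤ)) ^ 2 / (p.q + p.q⁻¹)) * (p.b * p.c) *
    (p.sig * p.zz - p.sigStar * p.qq)

/-- The structure constant `η*`. -/
def etaStar : ℂ :=
  -((p.q ^ 2 - p.q ^ (-2 : ℤ)) ^ 2 / (p.q + p.q⁻¹)) * (p.bs * p.cs) *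
    (p.sigStar * p.zz - p.sig * p.qq)

end Params

/-- `[X, Y]_r = r X Y - r⁻¹ Y X`. -/
def qComm {R : Type*} [Ring R] [Algebra ℂ R] (r : ℂ) (X Y : R) : R :=
  r • (X * Y) - r⁻¹ • (Y * X)

/-- The two generators of the Askey-Wilson algebra. -/
inductive Gen
  | A
  | As

/-- The defining relations of the Askey-Wilson algebra. -/
inductive AWRel (p : Params) : FreeAlgebra ℂ Gen → FreeAlgebra ℂ Gen → Prop
  | aw1 : AWRel p
      (qComm p.q⁻¹ (FreeAlgebra.ι ℂ Gen.A)
        (qComm p.q (FreeAlgebra.ι ℂ Gen.A) (FreeAlgebra.ι ℂ Gen.As)))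
      (p.rho • FreeAlgebra.ι ℂ Gen.As + p.omega • FreeAlgebra.ι ℂ Gen.A
        + p.eta • (1 : FreeAlgebra ℂ Gen))
  | aw2 : AWRel p
      (qComm p.q⁻¹ (FreeAlgebra.ι ℂ Gen.As)
        (qComm p.q (FreeAlgebra.ι ℂ Gen.As) (FreeAlgebra.ι ℂ Gen.A)))
      (p.rho • FreeAlgebra.ι ℂ Gen.A + p.omega • FreeAlgebra.ι ℂ Gen.As
        + p.etaStar • (1 : FreeAlgebra ℂ Gen))

/-- The Askey-Wilson algebra. -/
abbrev AW (p : Params) : Type := RingQuot (AWRel p)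

/-- The generator `A`. -/
def genA (p : Params) : AW p := RingQuot.mkAlgHom ℂ (AWRel p) (FreeAlgebra.ι ℂ Gen.A)

/-- The generator `A*`. -/
def genAs (p : Params) : AW p := RingQuot.mkAlgHom ℂ (AWRel p) (FreeAlgebra.ι ℂ Gen.As)

section Operators

variable (p : Params) (chi : ℂ)

/-- `η̄(u) = (q + q⁻¹) ρ⁻¹ (η u + η* u⁻¹)`. -/
def etaBar (u : ℂ) : ℂ := (p.q + p.q⁻¹) * p.rho⁻¹ * (p.eta * u + p.etaStar * u⁻¹)

/-! The entries `[[kA, kB], [kC, kD]]` of the solution `K(u)` of the reflection equation with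
coefficients in the Askey-Wilson algebra. -/

/-- Upper left entry of `K(u)`. -/
def kA (u : ℂ) : AW p :=
  bf (u ^ 2) • ((p.q * u) • genA p - (p.q * u)⁻¹ • genAs p) - etaBar p u • (1 : AW p)

/-- Lower right entry of `K(u)`. -/
def kD (u : ℂ) : AW p :=
  bf (u ^ 2) • ((p.q * u) • genAs p - (p.q * u)⁻¹ • genA p) - etaBar p u⁻¹ • (1 : AW p)

/-- Upper right entry of `K(u)`. -/
def kB (u : ℂ) : AW p :=
  (chi * bf (u ^ 2)) •
    (p.rho⁻¹ • (qComm p.q (genAs p) (genA p) + (p.omega / (p.q - p.q⁻¹)) • (1 : AW p))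
      + ((p.q * u ^ 2 + (p.q * u ^ 2)⁻¹) / (p.q ^ 2 - p.q ^ (-2 : ℤ))) • (1 : AW p))

/-- Lower left entry of `K(u)`. -/
def kC (u : ℂ) : AW p :=
  (p.rho * chi⁻¹ * bf (u ^ 2)) •
    (p.rho⁻¹ • (qComm p.q (genA p) (genAs p) + (p.omega / (p.q - p.q⁻¹)) • (1 : AW p))
      + ((p.q * u ^ 2 + (p.q * u ^ 2)⁻¹) / (p.q ^ 2 - p.q ^ (-2 : ℤ))) • (1 : AW p))

/-- `γ^ε(u,m) = α^{(1-ε)/2} β^{(1+ε)/2} q^{-m} u - α^{(1+ε)/2} β^{(1-ε)/2} q^m u⁻¹`, used for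
`ε = ±1` only. -/
def gam (eps : ℤ) (alpha beta u : ℂ) (m : ℤ) : ℂ :=
  alpha ^ ((1 - eps) / 2) * beta ^ ((1 + eps) / 2) * p.q ^ (-m) * u
    - alpha ^ ((1 + eps) / 2) * beta ^ ((1 - eps) / 2) * p.q ^ m * u⁻¹

/-- The dynamical operator `𝓑^ε(u,m)`, for `ε = ±1`: up to the normalization
`-ε (q u)^{-ε} / γ^ε(1,m+1)` it is the matrix element of the gauge transformed `K(u)` between the
row `(1, -β q^{-εm} u^ε)` and the column `(β q^{-εm} u^{-ε}, 1)`. -/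
def dynB (eps : ℤ) (alpha beta u : ℂ) (m : ℤ) : AW p :=
  (-(eps : ℂ) * (p.q * u) ^ (-eps) / gam p eps alpha beta 1 (m + 1)) •
    (kB p chi u
      + (beta * p.q ^ (-eps * m) * u ^ (-eps)) • kA p u
      - (beta * p.q ^ (-eps * m) * u ^ eps) • kD p u
      - (beta ^ 2 * p.q ^ (-2 * eps * m)) • kC p chi u)

/-- The string `B^ε(ū,m,M) = 𝓑^ε(u_1,m+2(M-1)) ⋯ 𝓑^ε(u_M,m)`; here `u_{i+1}` is `u i`. -/
def stringB (eps : ℤ) (alpha beta : ℂ) {M : ℕ} (u : Fin M → ℂ) (m : ℤ) : AW p :=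
  (List.ofFn fun i : Fin M =>
    dynB p chi eps alpha beta (u i) (m + 2 * ((M : ℤ) - 1 - (i : ℕ)))).prod

end Operators

section Bethe

variable (p : Params)

/-- `f(u,v)`. -/
def fFun (u v : ℂ) : ℂ :=
  bf (p.q * v / u) * bf (u * v) / (bf (v / u) * bf (p.q * u * v))

/-- `h(u,v)`. -/
def hFun (u v : ℂ) : ℂ :=
  bf (p.q ^ 2 * u * v) * bf (p.q * u / v) / (bf (p.q * u * v) * bf (u / v))

/-- `Λ₁^ε(u)`, for `ε = ±1`. -/
def Lambda1 (eps : ℤ) (u : ℂ) : ℂ :=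
  p.q ^ (-(p.n : ℤ) - 1) / u ^ eps
    * (p.q ^ (p.n + 1) * u * p.zeta⁻¹ - u⁻¹ * p.zeta)
    * (p.q ^ (p.n + 1) * u * p.zeta - u⁻¹ * p.zeta⁻¹)
    * (u * p.cs * p.q ^ (-(p.n : ℤ)) + u⁻¹ * p.b * p.q ^ p.n)
    * (u * (p.c / p.cs) ^ ((1 - eps) / 2) + u⁻¹ * (p.bs / p.b) ^ ((1 + eps) / 2))

/-- `Λ₂^ε(u)`, for `ε = ±1`. -/
def Lambda2 (eps : ℤ) (u : ℂ) : ℂ :=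
  bf (u ^ 2) * p.q ^ (-(p.n : ℤ) - 1) / (u ^ eps * bf (p.q * u ^ 2))
    * (p.q ^ ((p.n : ℤ) - 1) * u⁻¹ * p.zeta - u * p.zeta⁻¹)
    * (p.q ^ ((p.n : ℤ) - 1) * u⁻¹ * p.zeta⁻¹ - u * p.zeta)
    * (p.q ^ 2 * u * p.b * p.q ^ p.n + u⁻¹ * p.cs * p.q ^ (-(p.n : ℤ)))
    * (p.q ^ 2 * u * (p.bs / p.b) ^ ((1 + eps) / 2) + u⁻¹ * (p.c / p.cs) ^ ((1 - eps) / 2))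

/-- The Bethe function `E^M_ε(u_i, ū_i)` of homogeneous type. -/
def betheE (eps : ℤ) {M : ℕ} (u : Fin M → ℂ) (i : Fin M) : ℂ :=
  -(bf (u i ^ 2) / bf (p.q * u i ^ 2))
      * (∏ j ∈ Finset.univ.erase i, fFun p (u i) (u j)) * Lambda1 p eps (u i)
    + (∏ j ∈ Finset.univ.erase i, hFun p (u i) (u j)) * Lambda2 p eps (u i)

/-- The symmetrized Bethe root `U = (q u² + q⁻¹ u⁻²)/(q + q⁻¹)`. -/
def symRoot (u : ℂ) : ℂ := (p.q * u ^ 2 + p.q⁻¹ * (u ^ 2)⁻¹) / (p.q + p.q⁻¹)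

/-- `ū` is a set of non trivial (`u_i ≠ 0`, `u_i² ≠ u_i⁻²`) admissible (`U_i ≠ U_j`) roots of the
Bethe equations of homogeneous type; `b(q u_i²) ≠ 0` says that the equations, in which
`b(q u_i²)` is a denominator, are defined. -/
structure IsBetheRoots (eps : ℤ) {M : ℕ} (u : Fin M → ℂ) : Prop where
  ne_zero : ∀ i, u i ≠ 0
  nontrivial : ∀ i, bf (u i ^ 2) ≠ 0
  defined : ∀ i, bf (p.q * u i ^ 2) ≠ 0
  admissible : ∀ i j, i ≠ j → symRoot p (u i) ≠ symRoot p (u j)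
  bethe : ∀ i, betheE p eps u i = 0

end Bethe

section Representation

variable {p : Params} {V : Type*} [AddCommGroup V] [Module ℂ V]

/-- `V` is irreducible for the representation `π`. -/
def IsIrreducible (π : AW p →ₐ[ℂ] Module.End ℂ V) : Prop :=
  Nontrivial V ∧ ∀ W : Submodule ℂ V,
    (∀ a : AW p, ∀ x ∈ W, π a x ∈ W) → W = ⊥ ∨ W = ⊤

/-- The Bethe state `π(B^ε(ū,m₀,M)) |Ω⟩` at `β = 0`. -/
def betheState (π : AW p →ₐ[ℂ] Module.End ℂ V) (chi : ℂ) (eps : ℤ) (alpha : ℂ) (Omega : V)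
    {M : ℕ} (u : Fin M → ℂ) (m0 : ℤ) : V :=
  π (stringB p chi eps alpha 0 u m0) Omega

/-- The coefficient `X_{k+1,k}` of `|k+1⟩` in `X |k⟩`. -/
def lowerCoeff {n : ℕ} (v : Module.Basis (Fin (n + 1)) ℂ V) (X : Module.End ℂ V)
    (k : Fin n) : ℂ :=
  v.repr (X (v k.castSucc)) k.succ

end Representation

end QRacahBethe

end

open QRacahBethe

/-! At `β = 0` only the term `kB` survives in `dynB`, and `kB p chi u` is a scalar multiple of `Y -
y(u)`. Here `Y` is one fixed operator, the rescaled third generator `thirdGen` built from `[A*,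
A]_q`, and `y(u) = q u² + q⁻¹ u⁻²`. A Bethe state is therefore a scalar times `P(Y) v₀` with `P = ∏
(X - y(uⱼ))`, and the theorem says that such a vector is an eigenvector of `A`, with an explicit
normalization.

Eliminating `A*` from the two defining relations leaves a relation between `A` and `Y` that is
quadratic in `Y` (`third_relation`). It lets `A` be moved to the right past powers of `Y`. Hence `A
P(Y) v₀ = (T P)(Y) v₀` for a linear operator `T` on polynomials (`apply_aeval_eq_aeval_awOperator`),
once `A v₀` and `A Y v₀` are known. The latter requires the diagonal entry `A*₀₀`
(`diagonal_entry_zero`). It comes from the relations, or from the trace of `A*` in the case where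
the relations do not determine it.

Two properties of `T` finish the argument. It is triangular for the degree, with diagonal entries
`θ_k` (`degree_awOperator_sub_lt`). At a root `y` of its argument it acts as a `q`-difference
operator: the value of `T((X - y) S)` at `y` combines `S(y₊)` and `S(y₋)`, where `y₊`, `y₋` are the
shifts of `y` (`eval_awOperator_sub_mul`). The coefficients of this combination factor into `Λ₂` and
`Λ₁`, so the Bethe equations say exactly that `T P` vanishes at every root of `P`
(`eval_awOp_eq_zero`). Then `T P - θ_M P` has degree below `M` and `M` distinct zeros, so it
vanishes (`awOp_eq`), and `P(Y) v₀` is a multiple of `v_M`. The multiple is the product of the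
subdiagonal entries of `Y`, since `P` is monic and `Y` raises the index by at most one
(`repr_aeval_thirdGen`).

The statement for `A*` follows by exchanging `A` and `A*` while inverting `q` and the Bethe roots,
which fixes `Y` (`Params.dual`, `thirdGen_dual`). -/

open Polynomial

namespace QRacahBethe

/-! ### The relation between `A` and the third generator. -/

section Dual

variable {R : Type*} [Ring R] [Algebra ℂ R]

theorem qComm_qComm_inv {q : ℂ} (hq : q ≠ 0) (X Y : R) :
    qComm q⁻¹ X (qComm q X Y) = X * (X * Y) - (q ^ 2 + (q ^ 2)⁻¹) • (X * (Y * X)) + Y * (X * X) := by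
  simp only [qComm, mul_sub, sub_mul, mul_smul_comm, smul_mul_assoc, mul_assoc]
  match_scalars <;> field_simp
  ring

/-- The first Askey-Wilson relation in terms of `B = [A*, A]_q + ω / (q - q⁻¹)`. -/
theorem qComm_third_left {q rho om et : ℂ} (hq : q ≠ 0) (hqq : q - q⁻¹ ≠ 0) {A As B : R}
    (h : qComm q⁻¹ A (qComm q A As) = rho • As + om • A + et • (1 : R))
    (hB : B = qComm q As A + (om / (q - q⁻¹)) • (1 : R)) :
    qComm q A B = -(rho • As + et • (1 : R)) := by
  have e : qComm q A B = -qComm q⁻¹ A (qComm q A As) + om • A := by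
    have ht : om = (om / (q - q⁻¹)) * (q - q⁻¹) := (div_mul_cancel₀ _ hqq).symm
    rw [hB]
    nth_rewrite 2 [ht]
    generalize om / (q - q⁻¹) = t
    simp only [qComm, mul_sub, sub_mul, mul_add, add_mul, mul_smul_comm, smul_mul_assoc, mul_assoc,
      mul_one, one_mul]
    match_scalars <;> field_simp
    ring
  rw [e, h]
  module

/-- The second Askey-Wilson relation in terms of `B = [A*, A]_q + ω / (q - q⁻¹)`. -/
theorem qComm_third_right {q rho om ets : ℂ} (hq : q ≠ 0) (hqq : q - q⁻¹ ≠ 0) {A As B : R}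
    (h : qComm q⁻¹ As (qComm q As A) = rho • A + om • As + ets • (1 : R))
    (hB : B = qComm q As A + (om / (q - q⁻¹)) • (1 : R)) :
    qComm q B As = -(rho • A + ets • (1 : R)) := by
  have e : qComm q B As = -qComm q⁻¹ As (qComm q As A) + om • As := by
    have ht : om = (om / (q - q⁻¹)) * (q - q⁻¹) := (div_mul_cancel₀ _ hqq).symm
    rw [hB]
    nth_rewrite 2 [ht]
    generalize om / (q - q⁻¹) = t
    simp only [qComm, mul_sub, sub_mul, mul_add, add_mul, mul_smul_comm, smul_mul_assoc, mul_assoc,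
      mul_one, one_mul]
    match_scalars <;> field_simp
    ring
  rw [e, h]
  module

/-- The Askey-Wilson relation between `A` and a multiple of the third generator. -/
theorem third_relation {q rho om et ets e : ℂ} (hq : q ≠ 0) (hqq : q - q⁻¹ ≠ 0) (hrho : rho ≠ 0)
    {A As Y : R}
    (h1 : qComm q⁻¹ A (qComm q A As) = rho • As + om • A + et • (1 : R))
    (h2 : qComm q⁻¹ As (qComm q As A) = rho • A + om • As + ets • (1 : R))
    (hY : Y = e • (rho⁻¹ • (qComm q As A + (om / (q - q⁻¹)) • (1 : R)))) :
    A * (Y * Y) = (q ^ 2 + (q ^ 2)⁻¹) • (Y * (A * Y)) - Y * (Y * A)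
      - e ^ 2 • A + (e * (rho⁻¹ * et * (q - q⁻¹))) • Y - (e ^ 2 * (rho⁻¹ * ets)) • (1 : R) := by
  generalize hB : qComm q As A + (om / (q - q⁻¹)) • (1 : R) = B at hY
  have r1 := qComm_third_left hq hqq h1 hB.symm
  have r2 := qComm_third_right hq hqq h2 hB.symm
  -- The first relation expresses `A*` through `A` and `B`; inserting this in the second leaves a
  -- relation in `A` and `B` alone.
  have hAs : As = (-rho⁻¹) • (qComm q A B + et • (1 : R)) := by
    rw [r1]
    match_scalars <;> field_simp
    ring
  rw [hAs] at r2
  subst hY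
  have key : A * (B * B) = (q ^ 2 + (q ^ 2)⁻¹) • (B * (A * B)) - B * (B * A)
      - rho ^ 2 • A + (et * (q - q⁻¹)) • B - (rho * ets) • (1 : R) := by
    have r3 : (0 : R) = rho • (qComm q B (-rho⁻¹ • (qComm q A B + et • (1 : R)))
        + (rho • A + ets • (1 : R))) := by rw [r2]; simp
    rw [← sub_eq_zero]
    refine Eq.trans ?_ r3.symm
    simp only [qComm, mul_sub, sub_mul, mul_add, add_mul, mul_smul_comm, smul_mul_assoc, mul_assoc,
      mul_one, one_mul]
    match_scalars <;> field_simp <;> ring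
  simp only [mul_smul_comm, smul_mul_assoc, key]
  match_scalars <;> field_simp

end Dual

/-! ### The difference operator on polynomials. -/

section Recursion

variable (s d k1 k2 t0 t1 c0 : ℂ)

/-- The images of the monomials under the operator which `A` induces on polynomials in the third
generator. -/
noncomputable def awMonomial : ℕ → ℂ[X]
  | 0 => C t0
  | 1 => C t1 * X + C c0
  | (k + 2) => C s * X * awMonomial (k + 1) - (X ^ 2 + C d) * awMonomial k
      - (C k1 * X + C k2) * X ^ k

/-- The operator which `A` induces on polynomials in the third generator. -/
noncomputable def awOperator : ℂ[X] →ₗ[ℂ] ℂ[X] :=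
  (Polynomial.basisMonomials ℂ).constr ℂ (awMonomial s d k1 k2 t0 t1 c0)

theorem awOperator_X_pow (k : ℕ) :
    awOperator s d k1 k2 t0 t1 c0 (X ^ k) = awMonomial s d k1 k2 t0 t1 c0 k := by
  have := (Polynomial.basisMonomials ℂ).constr_basis ℂ (awMonomial s d k1 k2 t0 t1 c0) k
  rw [Polynomial.coe_basisMonomials] at this
  rw [awOperator]
  simpa only [Polynomial.monomial_one_right_eq_X_pow] using this

theorem linearMap_ext_X_pow {M : Type*} [AddCommGroup M] [Module ℂ M] {F G : ℂ[X] →ₗ[ℂ] M}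
    (h : ∀ k, F (X ^ k) = G (X ^ k)) : F = G := by
  refine (Polynomial.basisMonomials ℂ).ext fun k => ?_
  simpa [Polynomial.coe_basisMonomials, Polynomial.monomial_one_right_eq_X_pow] using h k

theorem linearMap_ext_of_recursion {M : Type*} [AddCommGroup M] [Module ℂ M] {F G : ℂ[X] →ₗ[ℂ] M}
    (h0 : F 1 = G 1) (h1 : F X = G X)
    (h : ∀ k, F (X ^ k) = G (X ^ k) → F (X ^ (k + 1)) = G (X ^ (k + 1)) →
      F (X ^ (k + 2)) = G (X ^ (k + 2))) : F = G := by
  refine linearMap_ext_X_pow fun k => ?_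
  have : F (X ^ k) = G (X ^ k) ∧ F (X ^ (k + 1)) = G (X ^ (k + 1)) := by
    induction k with
    | zero => simpa using ⟨h0, h1⟩
    | succ k ih => exact ⟨ih.2, h k ih.1 ih.2⟩
  exact this.1

theorem awOperator_one : awOperator s d k1 k2 t0 t1 c0 1 = C t0 := by
  simpa [awMonomial] using awOperator_X_pow s d k1 k2 t0 t1 c0 0

theorem awOperator_X : awOperator s d k1 k2 t0 t1 c0 X = C t1 * X + C c0 := by
  simpa [awMonomial] using awOperator_X_pow s d k1 k2 t0 t1 c0 1

theorem awOperator_sq_mul (S : ℂ[X]) :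
    awOperator s d k1 k2 t0 t1 c0 (X ^ 2 * S) =
      C s * X * awOperator s d k1 k2 t0 t1 c0 (X * S)
        - (X ^ 2 + C d) * awOperator s d k1 k2 t0 t1 c0 S - (C k1 * X + C k2) * S := by
  set T := awOperator s d k1 k2 t0 t1 c0 with hT
  have : T ∘ₗ LinearMap.mulLeft ℂ (X ^ 2) =
      LinearMap.mulLeft ℂ (C s * X) ∘ₗ T ∘ₗ LinearMap.mulLeft ℂ X
        - LinearMap.mulLeft ℂ (X ^ 2 + C d) ∘ₗ T - LinearMap.mulLeft ℂ (C k1 * X + C k2) := by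
    refine linearMap_ext_X_pow fun k => ?_
    simp only [LinearMap.sub_apply, LinearMap.comp_apply, LinearMap.mulLeft_apply, ← pow_add,
      ← pow_succ', hT, awOperator_X_pow]
    rw [add_comm 2 k, awMonomial]
  simpa [mul_assoc] using LinearMap.congr_fun this S

/-- For the polynomials `(X - y) X ^ k` the inhomogeneous term of the recursion vanishes at `y`. The
values at `y` of their images thus satisfy a homogeneous second order recurrence whose
characteristic roots are `yp` and `ym`, so they are a combination of `yp ^ k` and `ym ^ k` fixed by
the cases `k = 0, 1`. Linearity in `S` turns these powers into evaluations. -/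
theorem eval_awOperator_sub_mul {y yp ym : ℂ} (hs : yp + ym = s * y) (hd : yp * ym = y ^ 2 + d)
    (S : ℂ[X]) :
    (awOperator s d k1 k2 t0 t1 c0 ((X - C y) * S)).eval y * (yp - ym) =
      (s * y * (t1 * y + c0) - (y ^ 2 + d) * t0 - k1 * y - k2 - y * (t1 * y + c0)
          - ym * ((t1 - t0) * y + c0)) * S.eval yp
        - (s * y * (t1 * y + c0) - (y ^ 2 + d) * t0 - k1 * y - k2 - y * (t1 * y + c0)
          - yp * ((t1 - t0) * y + c0)) * S.eval ym := by
  set T := awOperator s d k1 k2 t0 t1 c0 with hT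
  have hy1 : (T (X - C y)).eval y = (t1 - t0) * y + c0 := by
    rw [map_sub, ← mul_one (C y), ← smul_eq_C_mul, map_smul, hT, awOperator_X, awOperator_one]
    simp
    ring
  have hy2 : (T ((X - C y) * X)).eval y =
      s * y * (t1 * y + c0) - (y ^ 2 + d) * t0 - k1 * y - k2 - y * (t1 * y + c0) := by
    have : (X - C y) * X = X ^ 2 * 1 - y • (X : ℂ[X]) := by rw [smul_eq_C_mul]; ring
    rw [this, map_sub, map_smul, hT, awOperator_sq_mul, mul_one, awOperator_X, awOperator_one]
    simp
    ring
  have hrec (S : ℂ[X]) : (T (X ^ 2 * S)).eval y =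
      s * y * (T (X * S)).eval y - (y ^ 2 + d) * (T S).eval y - (k1 * y + k2) * S.eval y := by
    rw [hT, awOperator_sq_mul]
    simp
  generalize s * y * (t1 * y + c0) - (y ^ 2 + d) * t0 - k1 * y - k2 - y * (t1 * y + c0) = a2
    at hy2 ⊢
  generalize (t1 - t0) * y + c0 = a1 at hy1 ⊢
  have : (yp - ym) • (Polynomial.leval y ∘ₗ T ∘ₗ LinearMap.mulLeft ℂ (X - C y)) =
      (a2 - ym * a1) • Polynomial.leval yp - (a2 - yp * a1) • Polynomial.leval ym := by
    refine linearMap_ext_of_recursion ?_ ?_ ?_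
    · simp only [LinearMap.sub_apply, LinearMap.smul_apply, LinearMap.comp_apply,
        LinearMap.mulLeft_apply, Polynomial.leval_apply, mul_one, hy1, eval_one, smul_eq_mul]
      ring
    · simp only [LinearMap.sub_apply, LinearMap.smul_apply, LinearMap.comp_apply,
        LinearMap.mulLeft_apply, Polynomial.leval_apply, hy2, eval_X, smul_eq_mul]
      ring
    · intro k e0 e1
      simp only [LinearMap.sub_apply, LinearMap.smul_apply, LinearMap.comp_apply,
        LinearMap.mulLeft_apply, Polynomial.leval_apply, eval_pow, eval_X, smul_eq_mul] at e0 e1 ⊢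
      have e2 := hrec ((X - C y) * X ^ k)
      have f2 : X ^ 2 * ((X - C y) * X ^ k) = (X - C y) * X ^ (k + 2) := by ring
      have f1 : X * ((X - C y) * X ^ k) = (X - C y) * X ^ (k + 1) := by ring
      rw [f1, f2] at e2
      simp only [eval_mul, eval_sub, eval_X, eval_C, sub_self, zero_mul, mul_zero] at e2
      rw [e2, ← hs, ← hd]
      linear_combination (yp + ym) * e1 - yp * ym * e0
  have := LinearMap.congr_fun this S
  simp only [LinearMap.sub_apply, LinearMap.smul_apply, LinearMap.comp_apply,
    LinearMap.mulLeft_apply, Polynomial.leval_apply, smul_eq_mul] at this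
  linear_combination this

/-- `awOperator` intertwines the action of `A` on the cyclic module generated by `x`. -/
theorem apply_aeval_eq_aeval_awOperator {V : Type*} [AddCommGroup V] [Module ℂ V]
    {A Y : Module.End ℂ V} {x : V} (h0 : A x = t0 • x) (h1 : A (Y x) = t1 • Y x + c0 • x)
    (hrel : A * (Y * Y) = s • (Y * (A * Y)) - Y * (Y * A) - d • A - k1 • Y
      - k2 • (1 : Module.End ℂ V)) (P : ℂ[X]) :
    A (aeval Y P x) = aeval Y (awOperator s d k1 k2 t0 t1 c0 P) x := by
  have : A ∘ₗ (LinearMap.applyₗ x) ∘ₗ (aeval Y).toLinearMap =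
      (LinearMap.applyₗ x) ∘ₗ (aeval Y).toLinearMap ∘ₗ awOperator s d k1 k2 t0 t1 c0 := by
    refine linearMap_ext_of_recursion ?_ ?_ ?_
    · simp [awOperator_one, h0, Module.algebraMap_end_apply]
    · simp [awOperator_X, h1, Module.algebraMap_end_apply]
    · intro k e0 e1
      have e := LinearMap.congr_fun hrel ((Y ^ k) x)
      have hk : X ^ (k + 2) = X ^ 2 * (X : ℂ[X]) ^ k := by ring
      have hk1 : X * (X : ℂ[X]) ^ k = X ^ (k + 1) := by ring
      simp only [LinearMap.comp_apply, AlgHom.toLinearMap_apply, LinearMap.applyₗ_apply_apply]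
        at e0 e1 ⊢
      rw [hk, awOperator_sq_mul, hk1]
      simp only [map_pow, aeval_X] at e0 e1
      simp only [map_sub, map_mul, map_add, map_pow, aeval_X, aeval_C, LinearMap.sub_apply,
        Module.End.mul_apply, LinearMap.add_apply, Module.algebraMap_end_apply,
        LinearMap.smul_apply, ← e0, ← e1, Module.End.one_apply] at e ⊢
      simp only [pow_succ', pow_zero, mul_one, Module.End.mul_apply]
      rw [e]
      module
  exact LinearMap.congr_fun this P

variable {s d k1 k2 t0 t1 c0}

/-- In the recursion only `s X T(X ^ (k + 1))` and `X² T(X ^ k)` reach degree `k + 2`, so the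
leading coefficients obey the recurrence imposed on `t`. -/
theorem coeff_awMonomial {t : ℕ → ℂ} (ht0 : t 0 = t0) (ht1 : t 1 = t1)
    (ht : ∀ k, t (k + 2) = s * t (k + 1) - t k) (k : ℕ) :
    ∀ j, k ≤ j → (awMonomial s d k1 k2 t0 t1 c0 k).coeff j = if j = k then t k else 0 := by
  induction k using Nat.strong_induction_on with
  | _ k ih =>
    match k with
    | 0 => intro j _; simp [awMonomial, ht0, coeff_C]
    | 1 =>
      intro j hj
      obtain ⟨j, rfl⟩ := Nat.exists_eq_add_of_le' hj
      simp [awMonomial, ht1, coeff_C]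
    | k + 2 =>
      intro j hj
      obtain ⟨j, rfl⟩ := Nat.exists_eq_add_of_le' (show 2 ≤ j by omega)
      have e1 := ih (k + 1) (by omega) (j + 1) (by omega)
      have e2 := ih k (by omega) j (by omega)
      have e3 := ih k (by omega) (j + 2) (by omega)
      rw [if_neg (by omega)] at e3
      have e4 : (C k1 * X + C k2) * X ^ k = C k1 * X ^ (k + 1) + C k2 * (X : ℂ[X]) ^ k := by ring
      rw [awMonomial, e4]
      simp only [coeff_sub, mul_assoc, coeff_C_mul, coeff_X_mul, add_mul, coeff_add,
        coeff_X_pow_mul, coeff_X_pow, e1, e2, e3, ht]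
      have h1 : (j + 2 = k + 1) ↔ False := iff_false_intro (by omega)
      have h2 : (j + 2 = k) ↔ False := iff_false_intro (by omega)
      simp only [add_left_inj, h1, h2]
      by_cases h : j = k <;> simp [h]

theorem degree_awOperator_sub_lt {t : ℕ → ℂ} (ht0 : t 0 = t0) (ht1 : t 1 = t1)
    (ht : ∀ k, t (k + 2) = s * t (k + 1) - t k) {P : ℂ[X]} (hP : P.Monic) :
    (awOperator s d k1 k2 t0 t1 c0 P - C (t P.natDegree) * P).degree < P.natDegree := by
  rw [degree_lt_iff_coeff_zero]
  intro j hj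
  have e : awOperator s d k1 k2 t0 t1 c0 P =
      ∑ k ∈ Finset.range (P.natDegree + 1), P.coeff k • awMonomial s d k1 k2 t0 t1 c0 k := by
    conv_lhs => rw [P.as_sum_range_C_mul_X_pow]
    simp only [map_sum, ← smul_eq_C_mul, map_smul, awOperator_X_pow]
  have h (k : ℕ) (hk : k ∈ Finset.range (P.natDegree + 1)) :
      (P.coeff k • awMonomial s d k1 k2 t0 t1 c0 k).coeff j =
        if k = j then P.coeff k * t k else 0 := by
    rw [Finset.mem_range] at hk
    rw [coeff_smul, coeff_awMonomial ht0 ht1 ht k j (by omega), smul_eq_mul, mul_ite, mul_zero]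
    simp only [eq_comm]
  rw [e, coeff_sub, finsetSum_coeff, Finset.sum_congr rfl h, coeff_C_mul,
    Finset.sum_ite_eq' (Finset.range (P.natDegree + 1)) j]
  rcases hj.eq_or_lt with rfl | hj
  · simp [hP.coeff_natDegree]
  · simp [coeff_eq_zero_of_natDegree_lt hj]

end Recursion

end QRacahBethe

/-! ### Parameters and scalar identities. -/

namespace QRacahBethe

namespace Params

variable {p : Params}

theorem sig_eq : p.sig = p.b * p.q ^ p.n + p.c / p.q ^ p.n := by
  simp [sig, div_eq_mul_inv]

theorem sigStar_eq : p.sigStar = p.bs * p.q ^ p.n + p.cs / p.q ^ p.n := by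
  simp [sigStar, div_eq_mul_inv]

theorem zz_eq : p.zz = p.zeta ^ 2 + 1 / p.zeta ^ 2 := by
  rw [zz, zpow_neg]
  norm_cast
  simp

theorem qq_eq : p.qq = p.q ^ p.n * p.q + 1 / (p.q ^ p.n * p.q) := by
  rw [qq, show -(p.n : ℤ) - 1 = -((p.n + 1 : ℕ) : ℤ) by push_cast; ring, zpow_neg, zpow_natCast,
    pow_succ, one_div]

theorem theta_eq (k : ℕ) : p.theta k = p.b * (p.q ^ 2) ^ k + p.c / (p.q ^ 2) ^ k := by
  rw [theta, zpow_neg, ← pow_mul, div_eq_mul_inv]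
  norm_cast

theorem thetaStar_eq (k : ℕ) : p.thetaStar k = p.bs * (p.q ^ 2) ^ k + p.cs / (p.q ^ 2) ^ k := by
  rw [thetaStar, zpow_neg, ← pow_mul, div_eq_mul_inv]
  norm_cast

theorem zpow_neg_two (q : ℂ) : q ^ (-2 : ℤ) = 1 / q ^ 2 := by
  rw [zpow_neg, one_div]
  norm_cast

theorem rho_eq : p.rho = -(p.b * p.c) * (p.q ^ 2 - 1 / p.q ^ 2) ^ 2 := by
  rw [rho, zpow_neg_two]

namespace Admissible

variable (hp : p.Admissible)

include hp

theorem q_pow_sub_one_ne_zero {k : ℕ} (hk : 0 < k) : p.q ^ k - 1 ≠ 0 :=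
  sub_ne_zero.2 (hp.q_not_root k hk)

theorem q_sq_add_one_ne_zero : p.q ^ 2 + 1 ≠ 0 := fun h =>
  hp.q_pow_sub_one_ne_zero (k := 4) (by norm_num) (by linear_combination (p.q ^ 2 - 1) * h)

theorem q_sub_inv_ne_zero : p.q - p.q⁻¹ ≠ 0 := by
  have h1 := hp.q_ne_zero
  have h2 := hp.q_pow_sub_one_ne_zero (k := 2) (by norm_num)
  have : p.q - p.q⁻¹ = (p.q ^ 2 - 1) / p.q := by field_simp
  rw [this]
  positivity

theorem q_add_inv_ne_zero : p.q + p.q⁻¹ ≠ 0 := by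
  have h1 := hp.q_ne_zero
  have h2 := hp.q_sq_add_one_ne_zero
  have : p.q + p.q⁻¹ = (p.q ^ 2 + 1) / p.q := by field_simp
  rw [this]
  positivity

theorem q_sq_sub_ne_zero : p.q ^ 2 - 1 / p.q ^ 2 ≠ 0 := by
  have h1 := hp.q_ne_zero
  have h2 := hp.q_pow_sub_one_ne_zero (k := 4) (by norm_num)
  have : p.q ^ 2 - 1 / p.q ^ 2 = (p.q ^ 4 - 1) / p.q ^ 2 := by field_simp
  rw [this]
  positivity

theorem rho_ne_zero : p.rho ≠ 0 := by
  rw [rho_eq]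
  exact mul_ne_zero (neg_ne_zero.2 (mul_ne_zero hp.b_ne_zero hp.c_ne_zero))
    (pow_ne_zero _ hp.q_sq_sub_ne_zero)

theorem pow_q_sq_inj {i j : ℕ} (h : (p.q ^ 2) ^ i = (p.q ^ 2) ^ j) : i = j := by
  have hq := hp.q_ne_zero
  wlog hij : i ≤ j generalizing i j
  · exact (this h.symm (le_of_not_ge hij)).symm
  obtain ⟨k, rfl⟩ := Nat.exists_eq_add_of_le hij
  by_contra hk
  refine hp.q_not_root (2 * k) (by omega) ?_
  rw [pow_add] at h
  rw [pow_mul]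
  exact (mul_left_cancel₀ (pow_ne_zero i (pow_ne_zero 2 hq))
    (by rw [mul_one, ← h] : (p.q ^ 2) ^ i * 1 = (p.q ^ 2) ^ i * (p.q ^ 2) ^ k)).symm

theorem eta_eq_mul : p.rho⁻¹ * p.eta = (p.sig * p.zz - p.sigStar * p.qq) / (p.q + p.q⁻¹) := by
  have h1 := hp.q_add_inv_ne_zero
  have h2 := hp.q_sq_sub_ne_zero
  have hb := hp.b_ne_zero
  have hc := hp.c_ne_zero
  rw [rho_eq, eta, zpow_neg_two]
  generalize p.q + p.q⁻¹ = x at *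
  generalize p.q ^ 2 - 1 / p.q ^ 2 = x at *
  field_simp

theorem etaStar_eq_mul :
    p.rho⁻¹ * p.etaStar = (p.sigStar * p.zz - p.sig * p.qq) / (p.q + p.q⁻¹) := by
  have h1 := hp.q_add_inv_ne_zero
  have h2 := hp.q_sq_sub_ne_zero
  have hb := hp.b_ne_zero
  have hc := hp.c_ne_zero
  rw [rho_eq, etaStar, zpow_neg_two, ← hp.bc_eq]
  generalize p.q + p.q⁻¹ = x at *
  generalize p.q ^ 2 - 1 / p.q ^ 2 = x at *
  field_simp

theorem bs_eq : p.bs = p.b * p.c / p.cs := by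
  rw [hp.bc_eq, mul_div_cancel_right₀ _ hp.cs_ne_zero]

end Admissible

/-- The constant term of the image of `X` under the operator induced by `A`. -/
noncomputable def shiftConst (p : Params) : ℂ :=
  -(p.q - 1 / p.q) * (p.zz * (p.b * p.q ^ p.n * p.q - p.c / (p.q ^ p.n * p.q))
    + p.sigStar * (p.q ^ p.n - 1 / p.q ^ p.n))

/-- The product of `θ₀ - θ₁` and the first diagonal entry of `A*`. -/
noncomputable def diagConst (p : Params) : ℂ :=
  -(p.q - 1 / p.q) * (p.b * p.c * p.zz * (p.q ^ p.n - 1 / p.q ^ p.n)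
    + p.sigStar * (p.b * p.q ^ p.n * p.q - p.c / (p.q ^ p.n * p.q)))

end Params

/-- Factorization of the coefficient of `S(y₋)` in `eval_awOperator_sub_mul`; up to a prefactor it
is `Λ₁`. Here `K` stands for `q ^ n`, `f` for `c*` and `Z` for `ζ`. -/
theorem lambda1_identity {q K b c f Z u bs sg ss z Q t0 t1 c0 k1 k2 y yp : ℂ}
    (hq : q ≠ 0) (hK : K ≠ 0) (hf : f ≠ 0) (hZ : Z ≠ 0) (hu : u ≠ 0) (hbs : bs = b * c / f)
    (hsg : sg = b * K + c / K) (hss : ss = bs * K + f / K) (hz : z = Z ^ 2 + 1 / Z ^ 2)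
    (hQ : Q = K * q + 1 / (K * q)) (ht0 : t0 = b + c) (ht1 : t1 = b * q ^ 2 + c / q ^ 2)
    (hc0 : c0 = -(q - 1 / q) * (z * (b * K * q - c / (K * q)) + ss * (K - 1 / K)))
    (hk1 : k1 = (q - 1 / q) ^ 2 * (sg * z - ss * Q))
    (hk2 : k2 = (q - 1 / q) ^ 2 * (q + 1 / q) * (ss * z - sg * Q))
    (hy : y = q * u ^ 2 + 1 / (q * u ^ 2)) (hyp : yp = q ^ 3 * u ^ 2 + 1 / (q ^ 3 * u ^ 2)) :
    (q - 1 / q) * (q ^ 2 - 1 / q ^ 2) * ((K * q)⁻¹ * (K * q * u / Z - Z / u)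
        * (K * q * u * Z - 1 / (u * Z)) * (u * f / K + b * K / u) * (u * (c / f) + 1 / u)) =
      (q ^ 2 + 1 / q ^ 2) * y * (t1 * y + c0) - (y ^ 2 + (q ^ 2 - 1 / q ^ 2) ^ 2) * t0 - k1 * y - k2
        - y * (t1 * y + c0) - yp * ((t1 - t0) * y + c0) := by
  subst hbs
  subst hsg hss hz hQ ht0 ht1
  subst hc0 hk1 hk2 hy hyp
  field_simp
  ring

/-- Companion factorization for the coefficient of `S(y₊)`, which gives `Λ₂`. -/
theorem lambda2_identity {q K b c f Z u bs sg ss z Q t0 t1 c0 k1 k2 y ym : ℂ}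
    (hq : q ≠ 0) (hK : K ≠ 0) (hf : f ≠ 0) (hZ : Z ≠ 0) (hu : u ≠ 0) (hbs : bs = b * c / f)
    (hsg : sg = b * K + c / K) (hss : ss = bs * K + f / K) (hz : z = Z ^ 2 + 1 / Z ^ 2)
    (hQ : Q = K * q + 1 / (K * q)) (ht0 : t0 = b + c) (ht1 : t1 = b * q ^ 2 + c / q ^ 2)
    (hc0 : c0 = -(q - 1 / q) * (z * (b * K * q - c / (K * q)) + ss * (K - 1 / K)))
    (hk1 : k1 = (q - 1 / q) ^ 2 * (sg * z - ss * Q))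
    (hk2 : k2 = (q - 1 / q) ^ 2 * (q + 1 / q) * (ss * z - sg * Q))
    (hy : y = q * u ^ 2 + 1 / (q * u ^ 2)) (hym : ym = u ^ 2 / q + q / u ^ 2) :
    (q - 1 / q) * (q ^ 2 - 1 / q ^ 2) * ((K * q)⁻¹ * (K / q / u * Z - u / Z)
        * (K / q / u / Z - u * Z) * (q ^ 2 * u * b * K + f / (u * K))
        * (q ^ 2 * u + c / f / u)) =
      (q ^ 2 + 1 / q ^ 2) * y * (t1 * y + c0) - (y ^ 2 + (q ^ 2 - 1 / q ^ 2) ^ 2) * t0 - k1 * y - k2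
        - y * (t1 * y + c0) - ym * ((t1 - t0) * y + c0) := by
  subst hbs
  subst hsg hss hz hQ ht0 ht1
  subst hc0 hk1 hk2 hy hym
  field_simp
  ring

/-- The factor on the left is `θ₀ - θ₋₁`. When it is nonzero it can be cancelled against the
diagonal relation at index `0`, which determines `A*₀₀`. -/
theorem diagConst_identity {q K b c sg ss z Q om et g : ℂ}
    (hq : q ≠ 0) (hK : K ≠ 0)
    (hsg : sg = b * K + c / K)
    (hQ : Q = K * q + 1 / (K * q)) (hom : om = (q - 1 / q) ^ 2 * (b * c * z * Q - sg * ss))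
    (het : et = -((q - 1 / q) ^ 2 * (q + 1 / q) * (b * c) * (sg * z - ss * Q)))
    (hg : g = -(q - 1 / q) * (b * c * z * (K - 1 / K) + ss * (b * K * q - c / (K * q)))) :
    (b + c - (b / q ^ 2 + c * q ^ 2)) * g = om * (b + c) + et := by
  subst hsg hQ
  subst hom het hg
  field_simp
  ring

theorem shiftConst_identity {q K b c sg ss z Q om g c0 : ℂ}
    (hq : q ≠ 0) (hK : K ≠ 0)
    (hsg : sg = b * K + c / K)
    (hQ : Q = K * q + 1 / (K * q)) (hom : om = (q - 1 / q) ^ 2 * (b * c * z * Q - sg * ss))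
    (hg : g = -(q - 1 / q) * (b * c * z * (K - 1 / K) + ss * (b * K * q - c / (K * q))))
    (hc0 : c0 = -(q - 1 / q) * (z * (b * K * q - c / (K * q)) + ss * (K - 1 / K))) :
    (q - 1 / q) ^ 2 * (b + c) * g + om * (b + c - (b * q ^ 2 + c / q ^ 2)) =
      (q - 1 / q) * (q ^ 2 - 1 / q ^ 2) * (b * c) * c0 := by
  subst hsg hQ
  subst hom hg hc0
  field_simp
  ring

/-- The case `b = c q²`, where `θ₋₁ = θ₀` and the diagonal relation at index `0` says nothing about
`a0`. The hypothesis `ha0` is the trace of `A*` after telescoping, and it is solved for `a0`. -/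
theorem trace_identity {q K c f bs sg ss z Q om et g a0 : ℂ}
    (hq : q ≠ 0) (hK : K ≠ 0) (hc : c ≠ 0) (hf : f ≠ 0) (h2 : q ^ 2 - 1 ≠ 0) (h2' : q ^ 2 + 1 ≠ 0)
    (hKq : (K ^ 2 * q ^ 2) ^ 2 - 1 ≠ 0)
    (hbs : bs = c * q ^ 2 * c / f)
    (hsg : sg = c * q ^ 2 * K + c / K) (hss : ss = bs * K + f / K)
    (hQ : Q = K * q + 1 / (K * q))
    (hom : om = (q - 1 / q) ^ 2 * (c * q ^ 2 * c * z * Q - sg * ss))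
    (het : et = -((q - 1 / q) ^ 2 * (q + 1 / q) * (c * q ^ 2 * c) * (sg * z - ss * Q)))
    (hg : g = -(q - 1 / q) * (c * q ^ 2 * c * z * (K - 1 / K)
      + ss * (c * q ^ 2 * K * q - c / (K * q))))
    {T : ℂ → ℂ}
    (hT : ∀ x, T x = (om / (q - 1 / q) ^ 2 + et * (c * q * (x + 1 / x))
      / (2 * (c * q ^ 2 * c) * (q + 1 / q) * (q - 1 / q) ^ 2)) / ((q ^ 2 - 1) * c * (x - 1 / x)))
    (ha0 : a0 + (T (K ^ 2 * q ^ 2) - T (q ^ 2)) =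
      bs * ((K ^ 2 * q ^ 2 - 1) / (q ^ 2 - 1))
        + f * ((1 / (K ^ 2 * q ^ 2) - 1) / (1 / q ^ 2 - 1))) :
    (c * q ^ 2 + c - (c * q ^ 2 * q ^ 2 + c / q ^ 2)) * a0 = g := by
  have e1 : q - 1 / q = (q ^ 2 - 1) / q := by field_simp
  have e2 : K ^ 2 * q ^ 2 - 1 / (K ^ 2 * q ^ 2) = ((K ^ 2 * q ^ 2) ^ 2 - 1) / (K ^ 2 * q ^ 2) := by
    field_simp
  have e3 : q ^ 2 - 1 / q ^ 2 = (q ^ 2 - 1) * (q ^ 2 + 1) / q ^ 2 := by field_simp; ring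
  have e4 : 1 / q ^ 2 - 1 = - (q ^ 2 - 1) / q ^ 2 := by field_simp; ring
  have e5 : q + 1 / q = (q ^ 2 + 1) / q := by field_simp
  rw [← eq_sub_iff_add_eq] at ha0
  rw [ha0, hT, hT]
  subst hbs
  subst hsg hss hQ
  subst hom het hg
  rw [e2, e3, e4, e1, e5]
  have h3 : -(q ^ 2 - 1) ≠ 0 := neg_ne_zero.2 h2
  generalize hA : q ^ 2 - 1 = A at *
  generalize hB : q ^ 2 + 1 = B at *
  generalize hC : (K ^ 2 * q ^ 2) ^ 2 - 1 = C at *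
  field_simp
  subst hA hB hC
  ring

end QRacahBethe

/-! ### The matrix of `A*` in the eigenbasis of `A`. -/

namespace QRacahBethe

/-- `A` and `A*` satisfy the Askey-Wilson relations, act irreducibly, `A` is diagonal with simple
spectrum in the basis `v`, and the trace of `A*` is the sum of the `θ*_k`. -/
structure IsAWEigenbasis {V : Type*} [AddCommGroup V] [Module ℂ V] (p : Params)
    (A As : Module.End ℂ V) (v : Module.Basis (Fin (p.n + 1)) ℂ V) : Prop where
  adm : p.Admissible
  rel : qComm p.q⁻¹ A (qComm p.q A As) = p.rho • As + p.omega • A + p.eta • 1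
  relStar : qComm p.q⁻¹ As (qComm p.q As A) = p.rho • A + p.omega • As + p.etaStar • 1
  irr : ∀ W : Submodule ℂ V, (∀ x ∈ W, A x ∈ W) → (∀ x ∈ W, As x ∈ W) → W = ⊥ ∨ W = ⊤
  theta_inj : ∀ M M' : ℕ, M ≤ p.n → M' ≤ p.n → p.theta M = p.theta M' → M = M'
  eig : ∀ M : Fin (p.n + 1), A (v M) = p.theta M • v M
  trace_star : LinearMap.trace ℂ V As = ∑ k ∈ Finset.range (p.n + 1), p.thetaStar k

namespace IsAWEigenbasis

variable {V : Type*} [AddCommGroup V] [Module ℂ V] {p : Params}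
  {A As : Module.End ℂ V} {v : Module.Basis (Fin (p.n + 1)) ℂ V}

theorem repr_apply (h : IsAWEigenbasis p A As v) (x : V) (i : Fin (p.n + 1)) :
    v.repr (A x) i = p.theta i * v.repr x i := by
  have : v.coord i ∘ₗ A = p.theta i • v.coord i := by
    refine v.ext fun j => ?_
    by_cases hij : j = i <;> simp [h.eig, hij]
  exact LinearMap.congr_fun this x

theorem repr_endomorphism (v : Module.Basis (Fin (p.n + 1)) ℂ V) (X : Module.End ℂ V) (x : V)
    (i : Fin (p.n + 1)) : v.repr (X x) i = ∑ j, v.repr x j * v.repr (X (v j)) i := by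
  conv_lhs => rw [← v.sum_repr x, map_sum, map_sum, Finsupp.finsetSum_apply]
  simp

/-- Matrix entry `(i, j)` of the first relation: `A` is diagonal, so the cubic relation is linear in
each entry of `A*`. -/
theorem entry_relation (h : IsAWEigenbasis p A As v) (i j : Fin (p.n + 1)) :
    (p.theta i ^ 2 - (p.q ^ 2 + (p.q ^ 2)⁻¹) * p.theta i * p.theta j + p.theta j ^ 2 - p.rho)
        * v.repr (As (v j)) i =
      (p.omega * p.theta j + p.eta) * if i = j then 1 else 0 := by
  have e := h.rel
  rw [qComm_qComm_inv h.adm.q_ne_zero] at e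
  have e' := congrArg (fun x => v.repr x i) (LinearMap.congr_fun e (v j))
  simp [h.eig, h.repr_apply, Finsupp.single_apply, eq_comm (a := j)] at e'
  split_ifs at e' ⊢ with hij
  · subst hij
    linear_combination e'
  · linear_combination e'

/-- As a quadratic in `θ_j`, the coefficient has roots `θ_{i-1}` and `θ_{i+1}`. The first is written
by division so that it makes sense at `i = 0`. -/
theorem factor_eq (hp : p.Admissible) (i j : ℕ) :
    (p.theta i ^ 2 - (p.q ^ 2 + (p.q ^ 2)⁻¹) * p.theta i * p.theta j + p.theta j ^ 2 - p.rho) =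
      (p.theta j - (p.b * ((p.q ^ 2) ^ i / p.q ^ 2) + p.c / ((p.q ^ 2) ^ i / p.q ^ 2)))
        * (p.theta j - p.theta (i + 1)) := by
  have hq := hp.q_ne_zero
  rw [p.theta_eq, p.theta_eq, p.theta_eq, p.rho_eq, pow_succ (p.q ^ 2) i]
  have hx : (p.q ^ 2) ^ i ≠ 0 := by positivity
  have hy : (p.q ^ 2) ^ j ≠ 0 := by positivity
  generalize (p.q ^ 2) ^ i = x at *
  generalize (p.q ^ 2) ^ j = y at *
  field_simp
  ring

theorem sub_eq_mul {b c x y : ℂ} (hx : x ≠ 0) (hy : y ≠ 0) :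
    b * x + c / x - (b * y + c / y) = (x - y) * (b * (x * y) - c) / (x * y) := by
  field_simp
  ring

theorem b_mul_ne (h : IsAWEigenbasis p A As v) {i j : ℕ} (hi : i ≤ p.n) (hj : j ≤ p.n)
    (hij : i ≠ j) : p.b * (p.q ^ 2) ^ (i + j) ≠ p.c := by
  intro e
  have hq := h.adm.q_ne_zero
  refine hij (h.theta_inj i j hi hj (sub_eq_zero.1 ?_))
  rw [p.theta_eq, p.theta_eq, sub_eq_mul (by positivity) (by positivity), ← pow_add, e]
  simp

/-- Away from the three diagonals neither factor of the entry relation vanishes. The neighbours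
`θ_{i-1}` and `θ_{i+1}` may lie outside the spectrum, so injectivity on the spectrum cannot be
quoted for them directly. -/
theorem tridiagonal (h : IsAWEigenbasis p A As v) {i j : Fin (p.n + 1)}
    (h1 : (i : ℕ) ≠ j) (h2 : (i : ℕ) ≠ j + 1) (h3 : (j : ℕ) ≠ i + 1) :
    v.repr (As (v j)) i = 0 := by
  have hq := h.adm.q_ne_zero
  have e := h.entry_relation i j
  rw [if_neg (fun e => h1 (congrArg _ e)), mul_zero] at e
  refine (mul_eq_zero.1 e).resolve_left ?_
  rw [factor_eq h.adm]
  have hi := i.2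
  have hj := j.2
  -- A coincidence with an out-of-range neighbour would force `b q^{2s} = c` with `s = i + j ± 1`.
  -- Since `i` and `j` are at least two apart, such an `s` is also a sum of two distinct indices in
  -- range: raise the smaller or lower the larger.
  have hn (s : ℕ) (hs1 : s = (i : ℕ) + j + 1 ∨ s + 1 = (i : ℕ) + j) :
      p.b * (p.q ^ 2) ^ s ≠ p.c := by
    rcases hs1 with rfl | hs1
    · rcases lt_or_gt_of_ne h1 with h' | h'
      · rw [show (i : ℕ) + j + 1 = (i + 1) + j by ring]
        exact h.b_mul_ne (by omega) (by omega) (by omega)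
      · rw [add_assoc]
        exact h.b_mul_ne (by omega) (by omega) (by omega)
    · rcases lt_or_gt_of_ne h1 with h' | h'
      · rw [show s = i + (j - 1) by omega]
        exact h.b_mul_ne (by omega) (by omega) (by omega)
      · rw [show s = (i - 1) + j by omega]
        exact h.b_mul_ne (by omega) (by omega) (by omega)
  refine mul_ne_zero ?_ ?_
  · rw [p.theta_eq, sub_eq_mul (by positivity) (by positivity)]
    refine div_ne_zero (mul_ne_zero ?_ (sub_ne_zero.2 ?_)) (by positivity)
    · rw [sub_ne_zero, ne_eq, eq_div_iff (by positivity), ← pow_succ]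
      intro e
      exact h2 (h.adm.pow_q_sq_inj e).symm
    · intro e
      obtain ⟨s, hs⟩ : ∃ s, s + 1 = (i : ℕ) + j := ⟨i + j - 1, by omega⟩
      refine hn s (Or.inr hs) ?_
      rw [← e, ← mul_div_assoc, ← pow_add, add_comm (j : ℕ), ← hs, pow_succ (p.q ^ 2) s]
      field_simp

  · rw [p.theta_eq, p.theta_eq, sub_eq_mul (by positivity) (by positivity), ← pow_add]
    refine div_ne_zero (mul_ne_zero ?_ (sub_ne_zero.2 ?_)) (by positivity)
    · rw [sub_ne_zero]
      exact fun e => h3 (h.adm.pow_q_sq_inj e)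
    · exact hn _ (Or.inl (by ring))

/-- If the entry vanished, the span of `v 0, …, v k`, here the common kernel of the later
coordinates, would be a proper nonzero invariant subspace. -/
theorem lowerCoeff_ne_zero (h : IsAWEigenbasis p A As v) (k : Fin p.n) :
    lowerCoeff v As k ≠ 0 := by
  intro h0
  let W : Submodule ℂ V := ⨅ i : {i : Fin (p.n + 1) // (k : ℕ) < i}, LinearMap.ker (v.coord i)
  have hW (x : V) : x ∈ W ↔ ∀ i : Fin (p.n + 1), (k : ℕ) < i → v.repr x i = 0 := by
    simp [W, Submodule.mem_iInf]
  have hk := k.2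
  rcases h.irr W
    (fun x hx => (hW _).2 fun i hi => by rw [h.repr_apply, (hW x).1 hx i hi, mul_zero])
    (fun x hx => (hW _).2 fun i hi => by
      rw [repr_endomorphism]
      refine Finset.sum_eq_zero fun j _ => ?_
      by_cases hj : (k : ℕ) < j
      · rw [(hW x).1 hx j hj, zero_mul]
      · by_cases hij : (i : ℕ) = k + 1 ∧ (j : ℕ) = k
        · have e1 : i = k.succ := Fin.ext (by simpa using hij.1)
          have e2 : j = k.castSucc := Fin.ext (by simpa using hij.2)
          rw [e1, e2]
          exact mul_eq_zero_of_right _ h0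
        · rw [h.tridiagonal (by omega) (by omega) (by omega), mul_zero]) with hW' | hW'
  · have : v 0 ∈ W := (hW _).2 fun i hi => by
      rw [v.repr_self, Finsupp.single_eq_of_ne]
      rintro rfl
      simp at hi
    rw [hW', Submodule.mem_bot] at this
    exact v.ne_zero 0 this
  · have : v k.succ ∈ W := hW' ▸ Submodule.mem_top
    have := (hW _).1 this k.succ (by simp)
    simp at this

theorem diagonal_entry (h : IsAWEigenbasis p A As v) (i : Fin (p.n + 1)) :
    (p.theta i - (p.b * ((p.q ^ 2) ^ (i : ℕ) / p.q ^ 2) + p.c / ((p.q ^ 2) ^ (i : ℕ) / p.q ^ 2)))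
        * (p.theta i - p.theta (i + 1)) * v.repr (As (v i)) i = p.omega * p.theta i + p.eta := by
  rw [← factor_eq h.adm, h.entry_relation, if_pos rfl, mul_one]

theorem trace_eq_sum (v : Module.Basis (Fin (p.n + 1)) ℂ V) (X : Module.End ℂ V) :
    LinearMap.trace ℂ V X = ∑ i, v.repr (X (v i)) i := by
  rw [LinearMap.trace_eq_matrix_trace ℂ v, Matrix.trace]
  simp [LinearMap.toMatrix_apply]

theorem omega_eq : p.omega =
    (p.q - 1 / p.q) ^ 2 * (p.b * p.c * p.zz * p.qq - p.sig * p.sigStar) := by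
  rw [Params.omega, one_div]

theorem eta_eq (hp : p.Admissible) : p.eta =
    -((p.q - 1 / p.q) ^ 2 * (p.q + 1 / p.q) * (p.b * p.c)
      * (p.sig * p.zz - p.sigStar * p.qq)) := by
  have hq := hp.q_ne_zero
  have h2 := hp.q_add_inv_ne_zero
  have : p.q ^ 2 - 1 / p.q ^ 2 = (p.q + p.q⁻¹) * (p.q - p.q⁻¹) := by field_simp; ring
  rw [Params.eta, Params.zpow_neg_two, this, one_div]
  generalize p.q + p.q⁻¹ = x at *
  generalize p.q - p.q⁻¹ = y at *
  field_simp

/-- Partial fractions: with `x = q^{2k}`, the denominators `θ_k - θ_{k-1}` and `θ_k - θ_{k+1}`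
become, up to sign, the values at `x` and `x q²` of a single function when `b = c q²`. The excluded
point `x² = 1` includes `k = 0`, where the diagonal relation degenerates. -/
theorem diagonal_telescope {q b c x om et a : ℂ} (hq : q ≠ 0) (hc : c ≠ 0) (hx : x ≠ 0)
    (h2 : q ^ 2 - 1 ≠ 0) (h2' : q ^ 2 + 1 ≠ 0) (hx1 : x ^ 2 - 1 ≠ 0)
    (hx2 : (x * q ^ 2) ^ 2 - 1 ≠ 0) (hb : b = c * q ^ 2) {T : ℂ → ℂ}
    (hT : ∀ x, T x = (om / (q - 1 / q) ^ 2 + et * (c * q * (x + 1 / x))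
      / (2 * (c * q ^ 2 * c) * (q + 1 / q) * (q - 1 / q) ^ 2)) / ((q ^ 2 - 1) * c * (x - 1 / x)))
    (ha : (b * x + c / x - (b * (x / q ^ 2) + c / (x / q ^ 2)))
      * (b * x + c / x - (b * (x * q ^ 2) + c / (x * q ^ 2))) * a = om * (b * x + c / x) + et) :
    a = T (x * q ^ 2) - T x := by
  have e1 : q - 1 / q = (q ^ 2 - 1) / q := by field_simp
  have e2 (x : ℂ) (hx : x ≠ 0) : x - 1 / x = (x ^ 2 - 1) / x := by field_simp
  have e5 : q + 1 / q = (q ^ 2 + 1) / q := by field_simp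
  have e6 : b * x + c / x - (b * (x / q ^ 2) + c / (x / q ^ 2)) =
      (q ^ 2 - 1) * c * (x ^ 2 - 1) / x := by
    rw [hb]; field_simp; ring
  have e7 : b * x + c / x - (b * (x * q ^ 2) + c / (x * q ^ 2)) =
      -((q ^ 2 - 1) * c * ((x * q ^ 2) ^ 2 - 1) / (x * q ^ 2)) := by
    rw [hb]; field_simp; ring
  have e8 : (q ^ 2 - 1) * c * (x ^ 2 - 1) / x
      * -((q ^ 2 - 1) * c * ((x * q ^ 2) ^ 2 - 1) / (x * q ^ 2)) ≠ 0 := by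
    refine mul_ne_zero ?_ (neg_ne_zero.2 ?_) <;> positivity
  rw [e6, e7] at ha
  refine mul_left_cancel₀ e8 (ha.trans ?_)
  rw [hT, hT, e2 _ hx, e2 (x * q ^ 2) (by positivity), e1, e5, hb]
  generalize hA : q ^ 2 - 1 = A at *
  generalize hB : q ^ 2 + 1 = B at *
  generalize hC : (x * q ^ 2) ^ 2 - 1 = C at *
  generalize hD : x ^ 2 - 1 = D at *
  field_simp
  subst hA hB hC hD
  ring

theorem sum_thetaStar (hp : p.Admissible) :
    ∑ k ∈ Finset.range (p.n + 1), p.thetaStar k =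
      p.bs * (((p.q ^ p.n) ^ 2 * p.q ^ 2 - 1) / (p.q ^ 2 - 1))
        + p.cs * ((1 / ((p.q ^ p.n) ^ 2 * p.q ^ 2) - 1) / (1 / p.q ^ 2 - 1)) := by
  have hq := hp.q_ne_zero
  have h2 := hp.q_pow_sub_one_ne_zero (k := 2) (by norm_num)
  have e : (p.q ^ p.n) ^ 2 * p.q ^ 2 = (p.q ^ 2) ^ (p.n + 1) := by ring
  rw [e, ← one_div_pow, ← geom_sum_eq (sub_ne_zero.1 h2), ← geom_sum_eq, Finset.mul_sum,
    Finset.mul_sum, ← Finset.sum_add_distrib]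
  · refine Finset.sum_congr rfl fun k _ => ?_
    rw [p.thetaStar_eq, one_div_pow, mul_one_div]
  · intro e
    rw [div_eq_iff (by positivity), one_mul] at e
    exact h2 (sub_eq_zero.2 e.symm)

/-- The entries with index at least `1` telescope, so the known trace of `A*` leaves the entry at
`0` as the only unknown. -/
theorem diagonal_entry_zero_of_degenerate (h : IsAWEigenbasis p A As v)
    (hdeg : p.b = p.c * p.q ^ 2) :
    (p.theta 0 - p.theta 1) * v.repr (As (v 0)) 0 = p.diagConst := by
  have hp := h.adm
  have hq := hp.q_ne_zero
  have hc := hp.c_ne_zero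
  have hK : p.q ^ p.n ≠ 0 := by positivity
  have h2 := hp.q_pow_sub_one_ne_zero (k := 2) (by norm_num)
  have h2' := hp.q_sq_add_one_ne_zero
  have hx (k : ℕ) (hk : 0 < k) : ((p.q ^ 2) ^ k) ^ 2 - 1 ≠ 0 := by
    rw [← pow_mul, ← pow_mul]
    exact hp.q_pow_sub_one_ne_zero (by positivity)
  obtain ⟨T, hT⟩ : ∃ T : ℂ → ℂ, ∀ x, T x = (p.omega / (p.q - 1 / p.q) ^ 2
      + p.eta * (p.c * p.q * (x + 1 / x))
      / (2 * (p.c * p.q ^ 2 * p.c) * (p.q + 1 / p.q) * (p.q - 1 / p.q) ^ 2))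
      / ((p.q ^ 2 - 1) * p.c * (x - 1 / x)) := ⟨_, fun _ => rfl⟩
  let a (k : ℕ) : ℂ := if hk : k < p.n + 1 then v.repr (As (v ⟨k, hk⟩)) ⟨k, hk⟩ else 0
  have ha (k : ℕ) (hk : k < p.n + 1) : a k = v.repr (As (v ⟨k, hk⟩)) ⟨k, hk⟩ := dif_pos hk
  have hsum (m : ℕ) (hm : m ≤ p.n) : ∑ k ∈ Finset.range (m + 1), a k =
      a 0 + (T ((p.q ^ 2) ^ (m + 1)) - T (p.q ^ 2)) := by
    induction m with
    | zero => simp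
    | succ m ih =>
      rw [Finset.sum_range_succ, ih (by omega), ha (m + 1) (by omega)]
      have e := h.diagonal_entry ⟨m + 1, by omega⟩
      rw [p.theta_eq, p.theta_eq] at e
      simp only [pow_succ _ (m + 1)] at e
      rw [diagonal_telescope hq hc (by positivity) h2 h2' (hx (m + 1) (by omega))
        (by rw [← pow_succ]; exact hx (m + 2) (by omega)) hdeg hT e, pow_succ _ (m + 1)]
      ring
  have htr : a 0 + (T ((p.q ^ p.n) ^ 2 * p.q ^ 2) - T (p.q ^ 2)) =
      p.bs * (((p.q ^ p.n) ^ 2 * p.q ^ 2 - 1) / (p.q ^ 2 - 1))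
        + p.cs * ((1 / ((p.q ^ p.n) ^ 2 * p.q ^ 2) - 1) / (1 / p.q ^ 2 - 1)) := by
    have e : (p.q ^ p.n) ^ 2 * p.q ^ 2 = (p.q ^ 2) ^ (p.n + 1) := by ring
    rw [← sum_thetaStar hp, ← h.trace_star, e, ← hsum p.n le_rfl, trace_eq_sum v,
      ← Fin.sum_univ_eq_sum_range]
    exact Finset.sum_congr rfl fun k _ => ha k k.2
  have key := trace_identity (g := p.diagConst) (z := p.zz) (Q := p.qq) hq hK hc hp.cs_ne_zero
    h2 h2'
    (by
      have := hx (p.n + 1) (by omega)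
      rwa [show (p.q ^ 2) ^ (p.n + 1) = (p.q ^ p.n) ^ 2 * p.q ^ 2 by ring] at this)
    (by rw [← hdeg, hp.bs_eq]) (sg := p.sig) (by rw [← hdeg, p.sig_eq]) p.sigStar_eq p.qq_eq
    (by rw [← hdeg, omega_eq]) (by rw [← hdeg, eta_eq hp])
    (by rw [← hdeg, Params.diagConst]) hT htr
  rw [← key, ← hdeg, ha 0 (by omega), p.theta_eq, p.theta_eq]
  simp

/-- The first diagonal entry of `A*`. -/
theorem diagonal_entry_zero (h : IsAWEigenbasis p A As v) :
    (p.theta 0 - p.theta 1) * v.repr (As (v 0)) 0 = p.diagConst := by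
  have hp := h.adm
  have hq := hp.q_ne_zero
  have hK : p.q ^ p.n ≠ 0 := by positivity
  have e := h.diagonal_entry 0
  have hg := diagConst_identity (ss := p.sigStar) (z := p.zz) hq hK p.sig_eq p.qq_eq
    omega_eq (eta_eq hp) (g := p.diagConst) rfl
  -- The dichotomy is whether `θ₋₁ = θ₀`.
  by_cases hdeg : p.b = p.c * p.q ^ 2
  · exact h.diagonal_entry_zero_of_degenerate hdeg
  · have ht0 : p.theta 0 = p.b + p.c := by simp [p.theta_eq]
    have hne : p.b + p.c - (p.b / p.q ^ 2 + p.c * p.q ^ 2) ≠ 0 := by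
      have h2 := hp.q_pow_sub_one_ne_zero (k := 2) (by norm_num)
      have : p.b + p.c - (p.b / p.q ^ 2 + p.c * p.q ^ 2) =
          (p.q ^ 2 - 1) * (p.b - p.c * p.q ^ 2) / p.q ^ 2 := by
        field_simp
        ring
      rw [this]
      exact div_ne_zero (mul_ne_zero h2 (sub_ne_zero.2 hdeg)) (by positivity)
    refine mul_left_cancel₀ hne ?_
    simp only [Fin.val_zero, pow_zero, ht0, zero_add] at e
    rw [hg, ← e, ht0]
    simp only [one_div, div_inv_eq_mul]
    ring

end IsAWEigenbasis

end QRacahBethe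

/-! ### The third generator as a raising operator. -/

namespace QRacahBethe

section ThirdGenerator

variable {V : Type*} [AddCommGroup V] [Module ℂ V]

/-- The third generator of the Askey-Wilson algebra, normalized so that the Bethe operators are
proportional to its translates by `q u² + q⁻¹ u⁻²`. -/
noncomputable def thirdGen (p : Params) (A As : Module.End ℂ V) : Module.End ℂ V :=
  (-(p.q ^ 2 - 1 / p.q ^ 2)) •
    (p.rho⁻¹ • (qComm p.q As A + (p.omega / (p.q - p.q⁻¹)) • (1 : Module.End ℂ V)))

variable {p : Params} {A As : Module.End ℂ V} {v : Module.Basis (Fin (p.n + 1)) ℂ V}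

namespace IsAWEigenbasis

theorem repr_thirdGen (h : IsAWEigenbasis p A As v) {i j : Fin (p.n + 1)} (hij : i ≠ j) :
    v.repr (thirdGen p A As (v j)) i = -(p.q ^ 2 - 1 / p.q ^ 2) * (p.rho⁻¹ *
      ((p.q * p.theta j - p.q⁻¹ * p.theta i) * v.repr (As (v j)) i)) := by
  simp only [thirdGen, qComm, LinearMap.smul_apply, LinearMap.add_apply, LinearMap.sub_apply,
    Module.End.mul_apply, Module.End.one_apply, map_smul, map_add, map_sub, Finsupp.smul_apply,
    Finsupp.add_apply, Finsupp.sub_apply, h.eig, h.repr_apply, smul_eq_mul, v.repr_self,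
    Finsupp.single_eq_of_ne hij]
  ring

/-- The commutator multiplies the entry of `A*` by `q θ_k - q⁻¹ θ_{k+1}`, in which the `b` terms
cancel; a pure power of `q` times `c` remains. -/
theorem lowerCoeff_thirdGen (h : IsAWEigenbasis p A As v) (k : Fin p.n) :
    lowerCoeff v (thirdGen p A As) k =
      (p.q ^ 2 - 1 / p.q ^ 2) / (-(p.q ^ 2 - 1 / p.q ^ 2) * p.rho)
        * (p.c * (p.q ^ 2 - 1 / p.q ^ 2) / (p.q * (p.q ^ 2) ^ (k : ℕ)))
        * (p.q ^ 2 - 1 / p.q ^ 2) * lowerCoeff v As k := by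
  have hq := h.adm.q_ne_zero
  have h1 := h.adm.rho_ne_zero
  have h2 := h.adm.q_sq_sub_ne_zero
  have e : p.q * p.theta k - p.q⁻¹ * p.theta (k + 1) =
      p.c * (p.q ^ 2 - 1 / p.q ^ 2) / (p.q * (p.q ^ 2) ^ (k : ℕ)) := by
    rw [p.theta_eq, p.theta_eq, pow_succ (p.q ^ 2)]
    have : (p.q ^ 2) ^ (k : ℕ) ≠ 0 := by positivity
    generalize (p.q ^ 2) ^ (k : ℕ) = x at *
    field_simp
    ring
  rw [lowerCoeff, h.repr_thirdGen (Fin.castSucc_lt_succ).ne', lowerCoeff]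
  simp only [Fin.val_castSucc, Fin.val_succ, e]
  generalize p.q ^ 2 - 1 / p.q ^ 2 = x at *
  field_simp

theorem repr_thirdGen_eq_zero (h : IsAWEigenbasis p A As v) {i j : Fin (p.n + 1)}
    (hij : (j : ℕ) + 1 < i) : v.repr (thirdGen p A As (v j)) i = 0 := by
  rw [h.repr_thirdGen (by rintro rfl; omega),
    h.tridiagonal (by omega) (by omega) (by omega)]
  simp

/-- Each application of the third generator raises the top index by at most one, so there is a
single path from `0` to `m` in `m` steps. -/
theorem repr_thirdGen_pow (h : IsAWEigenbasis p A As v) (m : ℕ) (hm : m ≤ p.n) :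
    (∀ i : Fin (p.n + 1), m < (i : ℕ) → v.repr ((thirdGen p A As ^ m) (v 0)) i = 0) ∧
      v.repr ((thirdGen p A As ^ m) (v 0)) ⟨m, Nat.lt_succ_of_le hm⟩ =
        ∏ k : Fin m, lowerCoeff v (thirdGen p A As) (k.castLE hm) := by
  induction m with
  | zero =>
    refine ⟨fun i hi => ?_, ?_⟩
    · rw [pow_zero, Module.End.one_apply, v.repr_self, Finsupp.single_eq_of_ne]
      rintro rfl
      simp at hi
    · simp
  | succ m ih =>
    obtain ⟨ih1, ih2⟩ := ih (by omega)
    have e (i : Fin (p.n + 1)) (hi : m < (i : ℕ)) :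
        v.repr ((thirdGen p A As ^ (m + 1)) (v 0)) i =
          v.repr ((thirdGen p A As ^ m) (v 0)) ⟨m, by omega⟩
            * v.repr (thirdGen p A As (v ⟨m, by omega⟩)) i := by
      rw [pow_succ', Module.End.mul_apply, repr_endomorphism]
      refine Finset.sum_eq_single _ (fun j _ hj => ?_) (by simp)
      have hj' : (j : ℕ) ≠ m := fun e => hj (Fin.ext e)
      rcases lt_or_gt_of_ne hj' with hj' | hj'
      · rw [h.repr_thirdGen_eq_zero (by omega), mul_zero]
      · rw [ih1 j hj', zero_mul]
    refine ⟨fun i hi => ?_, ?_⟩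
    · rw [e i (by omega), h.repr_thirdGen_eq_zero (by simpa using hi), mul_zero]
    · rw [e _ (by simp), ih2, Fin.prod_univ_castSucc]
      rfl

theorem repr_aeval_thirdGen (h : IsAWEigenbasis p A As v) {P : ℂ[X]} (hP : P.Monic)
    (hm : P.natDegree ≤ p.n) :
    v.repr (aeval (thirdGen p A As) P (v 0)) ⟨P.natDegree, Nat.lt_succ_of_le hm⟩ =
        ∏ k : Fin P.natDegree, lowerCoeff v (thirdGen p A As) (k.castLE hm) := by
  rw [← (h.repr_thirdGen_pow P.natDegree hm).2, aeval_eq_sum_range, LinearMap.sum_apply, map_sum,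
    Finsupp.finsetSum_apply, Finset.sum_range_succ, Finset.sum_eq_zero, zero_add,
    hP.coeff_natDegree, one_smul]
  intro k hk
  rw [Finset.mem_range] at hk
  rw [LinearMap.smul_apply, map_smul, Finsupp.smul_apply,
    (h.repr_thirdGen_pow k (by omega)).1 _ hk, smul_zero]

/-- `A* v₀` has components only along `v₀` and `v₁`, and `A - θ₁` kills the second. -/
theorem apply_star_zero (h : IsAWEigenbasis p A As v) :
    A (As (v 0)) = p.theta 1 • As (v 0) + p.diagConst • v 0 := by
  refine v.ext_elem fun i => ?_
  rw [h.repr_apply]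
  simp only [map_add, map_smul, Finsupp.add_apply, Finsupp.smul_apply, smul_eq_mul, v.repr_self]
  by_cases h0 : i = 0
  · rw [h0, ← h.diagonal_entry_zero]
    simp
    ring
  · rw [Finsupp.single_eq_of_ne h0]
    have h0' : (i : ℕ) ≠ 0 := fun e => h0 (Fin.ext e)
    by_cases h1 : (i : ℕ) = 1
    · rw [h1]
      ring
    · rw [h.tridiagonal (by simpa using h0') (by simpa using h1) (by simp)]
      ring

theorem apply_thirdGen_zero (h : IsAWEigenbasis p A As v) :
    A (thirdGen p A As (v 0)) = p.theta 1 • thirdGen p A As (v 0) + p.shiftConst • v 0 := by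
  have hp := h.adm
  have hq := hp.q_ne_zero
  have hb := hp.b_ne_zero
  have hc := hp.c_ne_zero
  have hK : p.q ^ p.n ≠ 0 := by positivity
  have hx := hp.q_sq_sub_ne_zero
  have hy := hp.q_sub_inv_ne_zero
  have h0 : A (v 0) = p.theta 0 • v 0 := h.eig 0
  have e := shiftConst_identity (ss := p.sigStar) (z := p.zz) (Q := p.qq) (om := p.omega)
    (g := p.diagConst) (c0 := p.shiftConst) hq hK p.sig_eq p.qq_eq
    omega_eq rfl rfl
  have ht0 : p.theta 0 = p.b + p.c := by simp [p.theta_eq]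
  have ht1 : p.theta 1 = p.b * p.q ^ 2 + p.c / p.q ^ 2 := by simp [p.theta_eq]
  rw [← ht0, ← ht1, one_div p.q] at e
  have hc0 : p.shiftConst = -(p.q ^ 2 - 1 / p.q ^ 2) * (p.rho⁻¹ *
      ((p.q - p.q⁻¹) * p.theta 0 * p.diagConst
        + p.omega / (p.q - p.q⁻¹) * (p.theta 0 - p.theta 1))) := by
    rw [p.rho_eq]
    generalize p.q ^ 2 - 1 / p.q ^ 2 = x at *
    generalize p.q - p.q⁻¹ = y at *
    field_simp
    linear_combination -e
  rw [hc0]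
  simp only [thirdGen, qComm, LinearMap.smul_apply, LinearMap.add_apply, LinearMap.sub_apply,
    Module.End.mul_apply, Module.End.one_apply, map_smul, map_add, map_sub, h0,
    h.apply_star_zero]
  module

end IsAWEigenbasis

end ThirdGenerator

/-! ### Bethe equations as vanishing conditions. -/

section BetheRoots

variable {p : Params}

/-- The eigenvalue `q u² + q⁻¹ u⁻²` of the third generator attached to `u`. -/
noncomputable def spectralValue (p : Params) (u : ℂ) : ℂ := p.q * u ^ 2 + 1 / (p.q * u ^ 2)

theorem spectralValue_eq (hp : p.Admissible) (u : ℂ) :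
    spectralValue p u = (p.q + p.q⁻¹) * symRoot p u := by
  rw [symRoot, mul_div_cancel₀ _ hp.q_add_inv_ne_zero, spectralValue, one_div, mul_inv]

/-- From `b(x) b(y) = xy + (xy)⁻¹ - x/y - y/x`: each product of two `b`'s is a difference of
spectral values, so the product of the `f(uᵢ, uⱼ)` is proportional to `S(y₋)`. In `hFun_eq` the
shift is `y₊`. -/
theorem fFun_eq (hq : p.q ≠ 0) {u w : ℂ} (hu : u ≠ 0) (hw : w ≠ 0) :
    fFun p u w = (u ^ 2 / p.q + p.q / u ^ 2 - spectralValue p w)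
      / (spectralValue p u - spectralValue p w) := by
  rw [fFun, ← neg_div_neg_eq]
  simp only [bf, spectralValue]
  congr 1 <;> field_simp <;> ring

theorem hFun_eq (hq : p.q ≠ 0) {u w : ℂ} (hu : u ≠ 0) (hw : w ≠ 0) :
    hFun p u w = (p.q ^ 3 * u ^ 2 + 1 / (p.q ^ 3 * u ^ 2) - spectralValue p w)
      / (spectralValue p u - spectralValue p w) := by
  rw [hFun]
  simp only [bf, spectralValue]
  congr 1 <;> field_simp <;> ring

/-- The coefficient of the third generator in its Askey-Wilson relation with `A`. -/
noncomputable def relConst₁ (p : Params) : ℂ :=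
  (p.q - 1 / p.q) ^ 2 * (p.sig * p.zz - p.sigStar * p.qq)

/-- The scalar term in the Askey-Wilson relation between `A` and the third generator. -/
noncomputable def relConst₂ (p : Params) : ℂ :=
  (p.q - 1 / p.q) ^ 2 * (p.q + 1 / p.q) * (p.sigStar * p.zz - p.sig * p.qq)

/-- The operator on polynomials in the third generator induced by `A`. -/
noncomputable def Params.awOp (p : Params) : ℂ[X] →ₗ[ℂ] ℂ[X] :=
  awOperator (p.q ^ 2 + 1 / p.q ^ 2) ((p.q ^ 2 - 1 / p.q ^ 2) ^ 2) (relConst₁ p) (relConst₂ p)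
    (p.theta 0) (p.theta 1) p.shiftConst

theorem Lambda1_neg_one_eq (hp : p.Admissible) {u : ℂ} (hu : u ≠ 0) :
    Lambda1 p (-1) u = u * ((p.q ^ p.n * p.q)⁻¹ * (p.q ^ p.n * p.q * u / p.zeta - p.zeta / u)
        * (p.q ^ p.n * p.q * u * p.zeta - 1 / (u * p.zeta))
        * (u * p.cs / p.q ^ p.n + p.b * p.q ^ p.n / u) * (u * (p.c / p.cs) + 1 / u)) := by
  have e1 : p.q ^ (-(p.n : ℤ) - 1) = (p.q ^ p.n * p.q)⁻¹ := by
    rw [show -(p.n : ℤ) - 1 = -((p.n + 1 : ℕ) : ℤ) by push_cast; ring, zpow_neg, zpow_natCast,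
      pow_succ]
  have e2 : p.q ^ (-(p.n : ℤ)) = (p.q ^ p.n)⁻¹ := by rw [zpow_neg, zpow_natCast]
  rw [Lambda1, e1, e2, pow_succ]
  norm_num
  have hq := hp.q_ne_zero
  have hz := hp.zeta_ne_zero
  have hcs := hp.cs_ne_zero
  have hK : p.q ^ p.n ≠ 0 := by positivity
  generalize p.q ^ p.n = K at *
  field_simp

theorem Lambda2_neg_one_eq (hp : p.Admissible) {u : ℂ} (hu : u ≠ 0) :
    Lambda2 p (-1) u = bf (u ^ 2) / bf (p.q * u ^ 2) * u * ((p.q ^ p.n * p.q)⁻¹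
      * (p.q ^ p.n / p.q / u * p.zeta - u / p.zeta)
        * (p.q ^ p.n / p.q / u / p.zeta - u * p.zeta)
        * (p.q ^ 2 * u * p.b * p.q ^ p.n + p.cs / (u * p.q ^ p.n))
        * (p.q ^ 2 * u + p.c / p.cs / u)) := by
  have hq := hp.q_ne_zero
  have e1 : p.q ^ (-(p.n : ℤ) - 1) = (p.q ^ p.n * p.q)⁻¹ := by
    rw [show -(p.n : ℤ) - 1 = -((p.n + 1 : ℕ) : ℤ) by push_cast; ring, zpow_neg, zpow_natCast,
      pow_succ]
  have e2 : p.q ^ (-(p.n : ℤ)) = (p.q ^ p.n)⁻¹ := by rw [zpow_neg, zpow_natCast]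
  have e3 : p.q ^ ((p.n : ℤ) - 1) = p.q ^ p.n / p.q := by
    rw [zpow_sub₀ hq, zpow_natCast, zpow_one]
  rw [Lambda2, e1, e2, e3]
  norm_num
  have hz := hp.zeta_ne_zero
  have hcs := hp.cs_ne_zero
  have hK : p.q ^ p.n ≠ 0 := by positivity
  generalize p.q ^ p.n = K at *
  generalize bf (u ^ 2) = x
  generalize bf (p.q * u ^ 2) = y
  field_simp

theorem mul_sub_mul_eq_zero {u b₁ b₂ D F₁ F₂ L₁ L₂ : ℂ} (hu : u ≠ 0) (h₁ : b₁ ≠ 0) (h₂ : b₂ ≠ 0)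
    (hD : D ≠ 0) (h : -(b₁ / b₂) * (F₁ / D) * (u * L₁) + F₂ / D * (b₁ / b₂ * u * L₂) = 0) :
    L₂ * F₂ - L₁ * F₁ = 0 := by
  have e : -(b₁ / b₂) * (F₁ / D) * (u * L₁) + F₂ / D * (b₁ / b₂ * u * L₂) =
      (L₂ * F₂ - L₁ * F₁) * (b₁ * u / (b₂ * D)) := by
    field_simp
    ring
  rw [e] at h
  exact (mul_eq_zero.1 h).resolve_right (by positivity)

/-- The Bethe equation at `uᵢ` says that the image of `∏ (X - yⱼ)` vanishes at `yᵢ`. -/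
theorem eval_awOp_eq_zero (hp : p.Admissible) {M : ℕ} {u : Fin M → ℂ}
    (hu : IsBetheRoots p (-1) u) (i : Fin M) :
    (p.awOp (∏ j, (X - C (spectralValue p (u j))))).eval (spectralValue p (u i)) = 0 := by
  have hq := hp.q_ne_zero
  have hui := hu.ne_zero i
  have hK : p.q ^ p.n ≠ 0 := by positivity
  have ht0 : p.theta 0 = p.b + p.c := by simp [p.theta_eq]
  have ht1 : p.theta 1 = p.b * p.q ^ 2 + p.c / p.q ^ 2 := by simp [p.theta_eq]
  have hx := hp.q_sq_sub_ne_zero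
  have h1 := lambda1_identity hq hK hp.cs_ne_zero hp.zeta_ne_zero hui hp.bs_eq p.sig_eq
    p.sigStar_eq p.zz_eq p.qq_eq ht0 ht1 (c0 := p.shiftConst) rfl (k1 := relConst₁ p) rfl
    (k2 := relConst₂ p) rfl (y := spectralValue p (u i)) rfl rfl
  have h2 := lambda2_identity hq hK hp.cs_ne_zero hp.zeta_ne_zero hui hp.bs_eq p.sig_eq
    p.sigStar_eq p.zz_eq p.qq_eq ht0 ht1 (c0 := p.shiftConst) rfl (k1 := relConst₁ p) rfl
    (k2 := relConst₂ p) rfl (y := spectralValue p (u i)) rfl rfl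
  have hev := eval_awOperator_sub_mul (p.q ^ 2 + 1 / p.q ^ 2) ((p.q ^ 2 - 1 / p.q ^ 2) ^ 2)
    (relConst₁ p) (relConst₂ p) (p.theta 0) (p.theta 1) p.shiftConst
    (y := spectralValue p (u i)) (yp := p.q ^ 3 * u i ^ 2 + 1 / (p.q ^ 3 * u i ^ 2))
    (ym := u i ^ 2 / p.q + p.q / u i ^ 2)
    (by rw [spectralValue]; field_simp; ring) (by rw [spectralValue]; field_simp; ring)
    (∏ j ∈ Finset.univ.erase i, (X - C (spectralValue p (u j))))
  rw [Finset.mul_prod_erase _ (fun j => X - C (spectralValue p (u j))) (Finset.mem_univ i), ← Params.awOp] at hev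
  -- This is `y₊ - y₋`; it is nonzero because `b(q uᵢ²) ≠ 0`, so the vanishing of the product gives
  -- that of the value.
  have hne : p.q ^ 3 * u i ^ 2 + 1 / (p.q ^ 3 * u i ^ 2) - (u i ^ 2 / p.q + p.q / u i ^ 2) =
      (p.q ^ 2 - 1 / p.q ^ 2) * bf (p.q * u i ^ 2) := by
    rw [bf]; field_simp; ring
  have hb := hu.bethe i
  have hb1 := hu.nontrivial i
  have hb2 := hu.defined i
  have hD : ∏ j ∈ Finset.univ.erase i, (spectralValue p (u i) - spectralValue p (u j)) ≠ 0 := by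
    refine Finset.prod_ne_zero_iff.2 fun j hj => ?_
    rw [spectralValue_eq hp, spectralValue_eq hp, ← mul_sub]
    exact mul_ne_zero hp.q_add_inv_ne_zero
      (sub_ne_zero.2 (hu.admissible i j (Finset.ne_of_mem_erase hj).symm))
  rw [betheE, Lambda1_neg_one_eq hp hui, Lambda2_neg_one_eq hp hui,
    Finset.prod_congr rfl (fun j _ => fFun_eq hq hui (hu.ne_zero j)),
    Finset.prod_congr rfl (fun j _ => hFun_eq hq hui (hu.ne_zero j)),
    Finset.prod_div_distrib, Finset.prod_div_distrib] at hb
  rw [hne, ← h1, ← h2] at hev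
  simp only [eval_prod, eval_sub, eval_X, eval_C] at hev
  refine (mul_eq_zero.1 (hev.trans ?_)).resolve_right (mul_ne_zero hx hb2)
  have := mul_sub_mul_eq_zero hui hb1 hb2 hD hb
  linear_combination (p.q - 1 / p.q) * (p.q ^ 2 - 1 / p.q ^ 2) * this

end BetheRoots

end QRacahBethe

/-! ### On-shell Bethe vectors are eigenvectors. -/

namespace QRacahBethe

section Eigenvectors

variable {V : Type*} [AddCommGroup V] [Module ℂ V] {p : Params} {A As : Module.End ℂ V}
  {v : Module.Basis (Fin (p.n + 1)) ℂ V}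

namespace IsAWEigenbasis

theorem apply_aeval_thirdGen (h : IsAWEigenbasis p A As v) (P : ℂ[X]) :
    A (aeval (thirdGen p A As) P (v 0)) = aeval (thirdGen p A As) (p.awOp P) (v 0) := by
  have hp := h.adm
  have hq := hp.q_ne_zero
  have hqq := hp.q_sub_inv_ne_zero
  have hqq' := hp.q_add_inv_ne_zero
  have e := third_relation hq hqq hp.rho_ne_zero h.rel h.relStar
    (Y := thirdGen p A As) (e := -(p.q ^ 2 - 1 / p.q ^ 2)) rfl
  have e1 : p.q ^ 2 - 1 / p.q ^ 2 = (p.q + p.q⁻¹) * (p.q - p.q⁻¹) := by field_simp; ring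
  have hk1 : -(p.q ^ 2 - 1 / p.q ^ 2) * (p.rho⁻¹ * p.eta * (p.q - p.q⁻¹)) = -relConst₁ p := by
    rw [hp.eta_eq_mul, relConst₁, e1, one_div]
    generalize p.q + p.q⁻¹ = x at *
    generalize p.q - p.q⁻¹ = y at *
    field_simp
  have hk2 : (-(p.q ^ 2 - 1 / p.q ^ 2)) ^ 2 * (p.rho⁻¹ * p.etaStar) = relConst₂ p := by
    rw [hp.etaStar_eq_mul, relConst₂, e1, one_div]
    generalize p.q + p.q⁻¹ = x at *
    generalize p.q - p.q⁻¹ = y at *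
    field_simp
  rw [hk1, hk2, neg_smul, neg_sq, ← sub_eq_add_neg, ← one_div] at e
  exact apply_aeval_eq_aeval_awOperator _ _ _ _ _ _ _ (h.eig 0) h.apply_thirdGen_zero e P

/-- The difference of the two sides has degree below `M` by triangularity, yet vanishes at the `M`
distinct values `y(uᵢ)`: the left term by the Bethe equations, the right one by construction. -/
theorem awOp_eq (hp : p.Admissible) {M : ℕ} {u : Fin M → ℂ} (hu : IsBetheRoots p (-1) u) :
    p.awOp (∏ j, (X - C (spectralValue p (u j)))) =
      C (p.theta M) * ∏ j, (X - C (spectralValue p (u j))) := by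
  have hq := hp.q_ne_zero
  have hmon : (∏ j, (X - C (spectralValue p (u j)))).Monic :=
    monic_prod_of_monic _ _ fun j _ => monic_X_sub_C _
  have hdeg : (∏ j, (X - C (spectralValue p (u j)))).natDegree = M := by
    rw [natDegree_prod_of_monic _ _ fun j _ => monic_X_sub_C _]
    simp
  have hlt := degree_awOperator_sub_lt (s := p.q ^ 2 + 1 / p.q ^ 2)
    (d := (p.q ^ 2 - 1 / p.q ^ 2) ^ 2) (k1 := relConst₁ p) (k2 := relConst₂ p)
    (c0 := p.shiftConst) (t := p.theta) rfl rfl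
    (fun k => by
      rw [p.theta_eq, p.theta_eq, p.theta_eq, pow_succ (p.q ^ 2) (k + 1), pow_succ (p.q ^ 2) k]
      have : (p.q ^ 2) ^ k ≠ 0 := by positivity
      generalize (p.q ^ 2) ^ k = x at *
      field_simp
      ring) hmon
  rw [← Params.awOp, hdeg] at hlt
  rw [← sub_eq_zero]
  have hinj : Function.Injective fun i => spectralValue p (u i) := by
    intro i j hij
    by_contra hne
    refine hu.admissible i j hne (mul_left_cancel₀ hp.q_add_inv_ne_zero ?_)
    rw [← spectralValue_eq hp, ← spectralValue_eq hp]
    exact hij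
  refine eq_zero_of_degree_lt_of_eval_finset_eq_zero
    (Finset.univ.image fun i => spectralValue p (u i)) ?_ ?_
  · rwa [Finset.card_image_of_injective _ hinj, Finset.card_univ, Fintype.card_fin]
  · intro x hx
    obtain ⟨i, -, rfl⟩ := Finset.mem_image.1 hx
    rw [eval_sub, eval_awOp_eq_zero hp hu i, eval_mul, eval_prod,
      Finset.prod_eq_zero (Finset.mem_univ i) (by simp)]
    simp

/-- The Bethe ansatz for `A`: on shell, the string of translates of the third generator maps the
reference state to a multiple of the eigenvector of `A`. -/
theorem prod_thirdGen_apply (h : IsAWEigenbasis p A As v) {M : ℕ} (hM : M ≤ p.n) {u : Fin M → ℂ}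
    (hu : IsBetheRoots p (-1) u) :
    (List.ofFn fun i => thirdGen p A As
        - spectralValue p (u i) • (1 : Module.End ℂ V)).prod (v 0) =
      (∏ k : Fin M, lowerCoeff v (thirdGen p A As) (k.castLE hM))
        • v ⟨M, Nat.lt_succ_of_le hM⟩ := by
  have hmon : (∏ j, (X - C (spectralValue p (u j)))).Monic :=
    monic_prod_of_monic _ _ fun j _ => monic_X_sub_C _
  have hdeg : (∏ j, (X - C (spectralValue p (u j)))).natDegree = M := by
    rw [natDegree_prod_of_monic _ _ fun j _ => monic_X_sub_C _]
    simp
  have hprod : (List.ofFn fun i => thirdGen p A As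
        - spectralValue p (u i) • (1 : Module.End ℂ V)).prod =
      aeval (thirdGen p A As) (∏ j, (X - C (spectralValue p (u j)))) := by
    rw [← List.prod_ofFn, map_list_prod, List.map_ofFn]
    congr 2
    funext i
    simp [Algebra.algebraMap_eq_smul_one]
  have hA := h.apply_aeval_thirdGen (∏ j, (X - C (spectralValue p (u j))))
  have hr := h.repr_aeval_thirdGen hmon (hdeg.trans_le hM)
  rw [awOp_eq h.adm hu, map_mul, aeval_C, Module.End.mul_apply, Module.algebraMap_end_apply] at hA
  rw [hprod]
  generalize ∏ j, (X - C (spectralValue p (u j))) = P at *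
  subst hdeg
  refine v.ext_elem fun i => ?_
  rw [map_smul, Finsupp.smul_apply, v.repr_self, smul_eq_mul]
  by_cases hi : i = ⟨P.natDegree, Nat.lt_succ_of_le hM⟩
  · rw [hi, hr, Finsupp.single_eq_same, mul_one]
  · rw [Finsupp.single_eq_of_ne hi, mul_zero]
    -- A nonzero coordinate at `i` would give `θ_i = θ_M`, against the simplicity of the spectrum.
    have e := congrArg (fun x => v.repr x i) hA
    simp only [h.repr_apply, map_smul, Finsupp.smul_apply, smul_eq_mul] at e
    by_contra hne
    exact hi (Fin.ext (h.theta_inj i _ (by omega) hM (mul_right_cancel₀ hne e)))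

end IsAWEigenbasis

end Eigenvectors

/-! ### Exchange of `A` and `A*`. -/

section Duality

/-- The parameters after exchanging the roles of `A` and `A*`. -/
noncomputable def Params.dual (p : Params) : Params :=
  ⟨p.n, p.q⁻¹, p.cs, p.bs, p.c, p.b, p.zeta⟩

variable {p : Params}

theorem Params.dual_theta (k : ℕ) : p.dual.theta k = p.thetaStar k := by
  rw [Params.theta_eq, Params.thetaStar_eq]
  simp [Params.dual, div_eq_mul_inv]
  ring

theorem Params.dual_thetaStar (k : ℕ) : p.dual.thetaStar k = p.theta k := by
  rw [Params.theta_eq, Params.thetaStar_eq]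
  simp [Params.dual, div_eq_mul_inv]
  ring

theorem Params.Admissible.dual (hp : p.Admissible) : p.dual.Admissible where
  q_ne_zero := inv_ne_zero hp.q_ne_zero
  q_not_root k hk := by
    simpa [Params.dual] using hp.q_not_root k hk
  b_ne_zero := hp.cs_ne_zero
  c_ne_zero := hp.bs_ne_zero
  bs_ne_zero := hp.c_ne_zero
  cs_ne_zero := hp.b_ne_zero
  zeta_ne_zero := hp.zeta_ne_zero
  bc_eq := by
    have := hp.bc_eq
    simp only [Params.dual]
    linear_combination -this

theorem Params.dual_rho (hp : p.Admissible) : p.dual.rho = p.rho := by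
  rw [Params.rho_eq, Params.rho_eq, hp.bc_eq]
  simp only [Params.dual, one_div, inv_pow, inv_inv]
  ring

theorem Params.dual_sig : p.dual.sig = p.sigStar := by
  rw [Params.sig_eq, Params.sigStar_eq]
  simp [Params.dual, div_eq_mul_inv]
  ring

theorem Params.dual_sigStar : p.dual.sigStar = p.sig := by
  rw [Params.sig_eq, Params.sigStar_eq]
  simp [Params.dual, div_eq_mul_inv]
  ring

theorem Params.dual_qq : p.dual.qq = p.qq := by
  rw [Params.qq_eq, Params.qq_eq]
  simp [Params.dual]
  ring

theorem Params.dual_omega (hp : p.Admissible) : p.dual.omega = p.omega := by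
  rw [Params.omega, Params.omega, dual_sig, dual_sigStar, dual_qq]
  simp only [Params.dual, Params.zz, inv_inv]
  linear_combination -(p.q - p.q⁻¹) ^ 2 * (p.zeta ^ 2 + p.zeta ^ (-2 : ℤ)) * p.qq * hp.bc_eq

theorem Params.dual_eta : p.dual.eta = p.etaStar := by
  rw [Params.eta, Params.etaStar, dual_sig, dual_sigStar, dual_qq, zpow_neg_two, zpow_neg_two]
  simp only [Params.dual, Params.zz, inv_inv, inv_pow, one_div]
  ring

theorem Params.dual_etaStar : p.dual.etaStar = p.eta := by
  rw [Params.eta, Params.etaStar, dual_sig, dual_sigStar, dual_qq, zpow_neg_two, zpow_neg_two]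
  simp only [Params.dual, Params.zz, inv_inv, inv_pow, one_div]
  ring

theorem bf_inv (x : ℂ) : bf x⁻¹ = -bf x := by
  simp [bf]

theorem fFun_dual (u w : ℂ) : fFun p.dual u⁻¹ w⁻¹ = fFun p u w := by
  have e1 : p.q⁻¹ * w⁻¹ / u⁻¹ = (p.q * w / u)⁻¹ := by simp [div_eq_mul_inv]; ring
  have e2 : u⁻¹ * w⁻¹ = (u * w)⁻¹ := by simp; ring
  have e3 : w⁻¹ / u⁻¹ = (w / u)⁻¹ := by simp [div_eq_mul_inv]; ring
  have e4 : p.q⁻¹ * u⁻¹ * w⁻¹ = (p.q * u * w)⁻¹ := by simp; ring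
  simp only [fFun, Params.dual, e1, e2, e3, e4, bf_inv, neg_mul_neg]

theorem hFun_dual (u w : ℂ) : hFun p.dual u⁻¹ w⁻¹ = hFun p u w := by
  have e1 : p.q⁻¹ * u⁻¹ / w⁻¹ = (p.q * u / w)⁻¹ := by simp [div_eq_mul_inv]; ring
  have e2 : p.q⁻¹ ^ 2 * u⁻¹ * w⁻¹ = (p.q ^ 2 * u * w)⁻¹ := by simp; ring
  have e3 : u⁻¹ / w⁻¹ = (u / w)⁻¹ := by simp [div_eq_mul_inv]; ring
  have e4 : p.q⁻¹ * u⁻¹ * w⁻¹ = (p.q * u * w)⁻¹ := by simp; ring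
  simp only [hFun, Params.dual, e1, e2, e3, e4, bf_inv, neg_mul_neg]

theorem Lambda1_dual (hp : p.Admissible) {u : ℂ} (hu : u ≠ 0) :
    Lambda1 p.dual (-1) u⁻¹ = Lambda1 p 1 u := by
  have hq := hp.q_ne_zero
  have hz := hp.zeta_ne_zero
  have hb := hp.b_ne_zero
  have hK : p.q ^ p.n ≠ 0 := by positivity
  have e1 : p.q ^ (-(p.n : ℤ) - 1) = (p.q ^ p.n * p.q)⁻¹ := by
    rw [show -(p.n : ℤ) - 1 = -((p.n + 1 : ℕ) : ℤ) by push_cast; ring, zpow_neg, zpow_natCast,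
      pow_succ]
  have e2 : p.q ^ (-(p.n : ℤ)) = (p.q ^ p.n)⁻¹ := by rw [zpow_neg, zpow_natCast]
  rw [Lambda1_neg_one_eq hp.dual (inv_ne_zero hu), Lambda1, e1, e2, pow_succ]
  norm_num
  simp only [Params.dual, inv_pow]
  generalize p.q ^ p.n = K at *
  field_simp
  ring

theorem Lambda2_dual (hp : p.Admissible) {u : ℂ} (hu : u ≠ 0) :
    Lambda2 p.dual (-1) u⁻¹ = Lambda2 p 1 u := by
  have hq := hp.q_ne_zero
  have hz := hp.zeta_ne_zero
  have hb := hp.b_ne_zero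
  have hK : p.q ^ p.n ≠ 0 := by positivity
  have e1 : p.q ^ (-(p.n : ℤ) - 1) = (p.q ^ p.n * p.q)⁻¹ := by
    rw [show -(p.n : ℤ) - 1 = -((p.n + 1 : ℕ) : ℤ) by push_cast; ring, zpow_neg, zpow_natCast,
      pow_succ]
  have e2 : p.q ^ (-(p.n : ℤ)) = (p.q ^ p.n)⁻¹ := by rw [zpow_neg, zpow_natCast]
  have e3 : p.q ^ ((p.n : ℤ) - 1) = p.q ^ p.n / p.q := by
    rw [zpow_sub₀ hq, zpow_natCast, zpow_one]
  rw [Lambda2_neg_one_eq hp.dual (inv_ne_zero hu), Lambda2, e1, e2, e3]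
  norm_num
  simp only [Params.dual, inv_pow]
  rw [← mul_inv, bf_inv, bf_inv]
  generalize p.q ^ p.n = K at *
  generalize bf (u ^ 2) = x
  generalize bf (p.q * u ^ 2) = y
  rw [neg_div_neg_eq]
  field_simp
  ring

theorem symRoot_dual (u : ℂ) : symRoot p.dual u⁻¹ = symRoot p u := by
  simp only [symRoot, Params.dual, inv_pow, inv_inv]
  rw [add_comm, add_comm p.q⁻¹]

/-- Inverting `q` and the roots replaces the arguments of `b` by their inverses. As `b` is odd under
inversion and enters the Bethe functions through ratios, the signs cancel. -/
theorem IsBetheRoots.dual (hp : p.Admissible) {M : ℕ} {u : Fin M → ℂ} (hu : IsBetheRoots p 1 u) :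
    IsBetheRoots p.dual (-1) fun i => (u i)⁻¹ where
  ne_zero i := inv_ne_zero (hu.ne_zero i)
  nontrivial i := by
    rw [inv_pow, bf_inv]
    exact neg_ne_zero.2 (hu.nontrivial i)
  defined i := by
    rw [inv_pow, Params.dual, ← mul_inv, bf_inv]
    exact neg_ne_zero.2 (hu.defined i)
  admissible i j hij := by
    rw [symRoot_dual, symRoot_dual]
    exact hu.admissible i j hij
  bethe i := by
    rw [← hu.bethe i, betheE, betheE, Lambda1_dual hp (hu.ne_zero i),
      Lambda2_dual hp (hu.ne_zero i)]
    simp only [fFun_dual, hFun_dual]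
    rw [inv_pow, show p.dual.q * (u i ^ 2)⁻¹ = (p.q * u i ^ 2)⁻¹ by
      rw [Params.dual, mul_inv], bf_inv, bf_inv, neg_div_neg_eq]

theorem qComm_inv {R : Type*} [Ring R] [Algebra ℂ R] (r : ℂ) (X Y : R) :
    qComm r⁻¹ X Y = -qComm r Y X := by
  simp [qComm]

/-- The `q`-commutator, `q - q⁻¹` and `q² - q⁻²` all change sign, while `ρ` and `ω` do not; the
signs compensate. -/
theorem thirdGen_dual {V : Type*} [AddCommGroup V] [Module ℂ V] (hp : p.Admissible)
    (A As : Module.End ℂ V) : thirdGen p.dual As A = thirdGen p A As := by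
  have e : p.omega / (p.q⁻¹ - p.q) = -(p.omega / (p.q - p.q⁻¹)) := by
    rw [← neg_sub p.q, div_neg]
  rw [thirdGen, Params.dual_rho hp, Params.dual_omega hp, thirdGen]
  simp only [Params.dual, inv_inv, qComm_inv, e, inv_pow, one_div]
  module

theorem spectralValue_dual (u : ℂ) : spectralValue p.dual u⁻¹ = spectralValue p u := by
  simp only [spectralValue, Params.dual, one_div, inv_pow, mul_inv, inv_inv]
  ring

end Duality

end QRacahBethe

/-! ### From the algebra to operators on the representation. -/

namespace QRacahBethe

theorem map_qComm {R S : Type*} [Ring R] [Algebra ℂ R] [Ring S] [Algebra ℂ S] (f : R →ₐ[ℂ] S)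
    (r : ℂ) (X Y : R) : f (qComm r X Y) = qComm r (f X) (f Y) := by
  simp [qComm]

theorem genA_relation (p : Params) : qComm p.q⁻¹ (genA p) (qComm p.q (genA p) (genAs p)) =
    p.rho • genAs p + p.omega • genA p + p.eta • 1 := by
  have e := RingQuot.mkAlgHom_rel ℂ (AWRel.aw1 (p := p))
  simp only [map_qComm, map_add, map_smul, map_one] at e
  exact e

theorem genAs_relation (p : Params) : qComm p.q⁻¹ (genAs p) (qComm p.q (genAs p) (genA p)) =
    p.rho • genA p + p.omega • genAs p + p.etaStar • 1 := by
  have e := RingQuot.mkAlgHom_rel ℂ (AWRel.aw2 (p := p))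
  simp only [map_qComm, map_add, map_smul, map_one] at e
  exact e

section Representation

variable {p : Params} {V : Type*} [AddCommGroup V] [Module ℂ V]
  {π : AW p →ₐ[ℂ] Module.End ℂ V}

theorem apply_mem_of_generators {W : Submodule ℂ V} (hA : ∀ x ∈ W, π (genA p) x ∈ W)
    (hAs : ∀ x ∈ W, π (genAs p) x ∈ W) (a : AW p) : ∀ x ∈ W, π a x ∈ W := by
  obtain ⟨y, rfl⟩ := RingQuot.mkAlgHom_surjective ℂ (AWRel p) a
  induction y using FreeAlgebra.induction with
  | grade0 r =>
    intro x hx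
    rw [AlgHom.commutes, AlgHom.commutes, Module.algebraMap_end_apply]
    exact W.smul_mem r hx
  | grade1 g => cases g; exacts [hA, hAs]
  | mul a b ha hb =>
    intro x hx
    rw [map_mul, map_mul, Module.End.mul_apply]
    exact ha _ (hb x hx)
  | add a b ha hb =>
    intro x hx
    rw [map_add, map_add, LinearMap.add_apply]
    exact W.add_mem (ha x hx) (hb x hx)

theorem trace_eq_sum_of_eigenbasis {n : ℕ} (v : Module.Basis (Fin (n + 1)) ℂ V)
    {X : Module.End ℂ V} {t : ℕ → ℂ} (hX : ∀ k : Fin (n + 1), X (v k) = t k • v k) :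
    LinearMap.trace ℂ V X = ∑ k ∈ Finset.range (n + 1), t k := by
  rw [LinearMap.trace_eq_matrix_trace ℂ v, Matrix.trace, ← Fin.sum_univ_eq_sum_range]
  exact Finset.sum_congr rfl fun k _ => by simp [LinearMap.toMatrix_apply, hX]

theorem list_ofFn_smul_prod {R : Type*} [Ring R] [Algebra ℂ R] {M : ℕ} (c : Fin M → ℂ)
    (x : Fin M → R) :
    (List.ofFn fun i => c i • x i).prod = (∏ i, c i) • (List.ofFn x).prod := by
  induction M with
  | zero => simp
  | succ M ih =>
    rw [List.ofFn_succ, List.ofFn_succ, List.prod_cons, List.prod_cons, ih, Fin.prod_univ_succ,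
      smul_mul_smul_comm]

theorem kB_apply (hp : p.Admissible) (chi u : ℂ) : π (kB p chi u) =
    (chi * bf (u ^ 2) / -(p.q ^ 2 - 1 / p.q ^ 2)) •
      (thirdGen p (π (genA p)) (π (genAs p))
        - spectralValue p u • (1 : Module.End ℂ V)) := by
  have hx := hp.q_sq_sub_ne_zero
  have hr := hp.rho_ne_zero
  rw [kB, Params.zpow_neg_two, thirdGen, spectralValue]
  simp only [map_smul, map_add, map_qComm, map_one, one_div] at hx ⊢
  generalize p.q ^ 2 - (p.q ^ 2)⁻¹ = x at *
  match_scalars <;> field_simp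
  ring

/-- At `β = 0` the gauge factor `γ⁻(1, m + 1)` reduces to `α q^{-(m+1)}`. The scalar is split into
the part depending on `u`, which goes into the normalization, and the dynamical part, which `α`
compensates. -/
theorem dynB_neg_one (hp : p.Admissible) (chi alpha u : ℂ) (m : ℤ) :
    π (dynB p chi (-1) alpha 0 u m) =
      (p.q * u * bf (u ^ 2) *
        (chi / (alpha * p.q ^ (-(m + 1)) * -(p.q ^ 2 - 1 / p.q ^ 2)))) •
      (thirdGen p (π (genA p)) (π (genAs p))
        - spectralValue p u • (1 : Module.End ℂ V)) := by
  rw [dynB, gam]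
  norm_num
  rw [kB_apply hp, smul_smul]
  congr 1
  simp only [div_eq_mul_inv, mul_inv, one_mul]
  ring

theorem dynB_one (hp : p.Admissible) (chi alpha u : ℂ) (m : ℤ) :
    π (dynB p chi 1 alpha 0 u m) =
      (-p.q⁻¹ * u⁻¹ * bf (u ^ 2) *
        (chi / (alpha * p.q ^ (m + 1) * (p.q ^ 2 - 1 / p.q ^ 2)))) •
      (thirdGen p (π (genA p)) (π (genAs p))
        - spectralValue p u • (1 : Module.End ℂ V)) := by
  rw [dynB, gam]
  norm_num
  rw [kB_apply hp, smul_smul]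
  rw [← neg_smul]
  congr 1
  simp only [div_eq_mul_inv, mul_inv, one_mul, inv_neg]
  ring

/-- Bookkeeping of scalars. The index of `d` is reversed because the rightmost operator of the
string acts first and carries the parameter `m₀`. -/
theorem eq_prod_inv_smul {M : ℕ} {a d l t : Fin M → ℂ} (ha : ∀ k, a k ≠ 0) (hl : ∀ k, l k ≠ 0)
    (h : ∀ k, d k.rev * t k = l k) {x y : V} (hx : x = (∏ k, t k) • y) :
    y = (∏ k, (a k * l k)⁻¹) • ((∏ k, (a k * d k)) • x) := by
  have e : (∏ k, d k) * ∏ k, t k = ∏ k, l k := by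
    rw [← Equiv.prod_comp Fin.revPerm d, ← Finset.prod_mul_distrib]
    exact Finset.prod_congr rfl fun k _ => h k
  rw [hx, smul_smul, smul_smul, Finset.prod_mul_distrib, mul_assoc (∏ k, (a k * l k)⁻¹),
    mul_assoc (∏ k, a k), e,
    ← Finset.prod_mul_distrib, ← Finset.prod_mul_distrib, Finset.prod_eq_one, one_smul]
  exact fun k _ => inv_mul_cancel₀ (mul_ne_zero (ha k) (hl k))

end Representation

end QRacahBethe

open QRacahBethe

theorem mainTheorem3 (p : Params) (hp : p.Admissible)
    {V : Type*} [AddCommGroup V] [Module ℂ V]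
    (π : AW p →ₐ[ℂ] Module.End ℂ V) (hirr : IsIrreducible π)
    -- the spectra are multiplicity-free
    (hθ : ∀ M M' : ℕ, M ≤ p.n → M' ≤ p.n → p.theta M = p.theta M' → M = M')
    (hθs : ∀ N N' : ℕ, N ≤ p.n → N' ≤ p.n → p.thetaStar N = p.thetaStar N' → N = N')
    -- the eigenbases of `π(A)` and `π(A*)`
    (v : Module.Basis (Fin (p.n + 1)) ℂ V)
    (hv : ∀ M : Fin (p.n + 1), π (genA p) (v M) = p.theta M • v M)
    (vs : Module.Basis (Fin (p.n + 1)) ℂ V)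
    (hvs : ∀ N : Fin (p.n + 1), π (genAs p) (vs N) = p.thetaStar N • vs N)
    (chi : ℂ) (hchi : chi ≠ 0) (m0 : ℤ)
    -- the values of `α` in the states `Ψ_-` and `Ψ_+`
    (alpha_m alpha_p : ℂ)
    (halpha_m : (p.q ^ 2 - p.q ^ (-2 : ℤ)) * chi⁻¹ * alpha_m * p.b * p.q ^ (-m0) = -1)
    (halpha_p : (p.q ^ 2 - p.q ^ (-2 : ℤ)) * chi⁻¹ * alpha_p * p.cs * p.q ^ m0 = 1) :
    (∀ (M : ℕ) (hM : M ≤ p.n) (u : Fin M → ℂ), IsBetheRoots p (-1) u →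
      v ⟨M, Nat.lt_succ_of_le hM⟩ =
        (∏ k : Fin M, (p.q * u k * bf (u k ^ 2)
            * lowerCoeff v (π (genAs p)) (k.castLE hM))⁻¹) •
          betheState π chi (-1) alpha_m (v 0) u m0) ∧
    (∀ (N : ℕ) (hN : N ≤ p.n) (w : Fin N → ℂ), IsBetheRoots p 1 w →
      vs ⟨N, Nat.lt_succ_of_le hN⟩ =
        (∏ k : Fin N, (-p.q⁻¹ * (w k)⁻¹ * bf (w k ^ 2)
            * lowerCoeff vs (π (genA p)) (k.castLE hN))⁻¹) •
          betheState π chi 1 alpha_p (vs 0) w m0) := by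
  have hq := hp.q_ne_zero
  have hx := hp.q_sq_sub_ne_zero
  have rel := congrArg π (genA_relation p)
  have relStar := congrArg π (genAs_relation p)
  simp only [map_qComm, map_add, map_smul, map_one] at rel relStar
  rw [Params.zpow_neg_two] at halpha_m halpha_p
  have h : IsAWEigenbasis p (π (genA p)) (π (genAs p)) v :=
    { adm := hp
      rel := rel
      relStar := relStar
      irr := fun W hA hAs => hirr.2 W (apply_mem_of_generators hA hAs)
      theta_inj := hθ
      eig := hv
      -- The eigenbasis of `A*` enters the first half only through this trace.
      trace_star := trace_eq_sum_of_eigenbasis vs hvs }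
  have h' : IsAWEigenbasis p.dual (π (genAs p)) (π (genA p)) vs :=
    { adm := hp.dual
      rel := by
        rw [Params.dual_rho hp, Params.dual_omega hp, Params.dual_eta, ← relStar]
        simp only [Params.dual]
        -- The expanded cubic expression involves only `q² + q⁻²`, hence is unchanged under `q ↦
        -- q⁻¹`.
        rw [qComm_qComm_inv (inv_ne_zero hq), qComm_qComm_inv hq]
        simp [add_comm]
      relStar := by
        rw [Params.dual_rho hp, Params.dual_omega hp, Params.dual_etaStar, ← rel]
        simp only [Params.dual]
        rw [qComm_qComm_inv (inv_ne_zero hq), qComm_qComm_inv hq]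
        simp [add_comm]
      irr := fun W hAs hA => hirr.2 W (apply_mem_of_generators hA hAs)
      theta_inj := by simp only [Params.dual_theta]; exact hθs
      eig := fun M => by rw [Params.dual_theta]; exact hvs M
      trace_star := by
        simp only [Params.dual_thetaStar]
        exact trace_eq_sum_of_eigenbasis v hv }
  constructor
  · intro M hM u hu
    have key := h.prod_thirdGen_apply hM hu
    rw [betheState, stringB, map_list_prod, List.map_ofFn]
    simp only [Function.comp_def, dynB_neg_one hp]
    rw [list_ofFn_smul_prod, LinearMap.smul_apply]
    refine eq_prod_inv_smul (fun k => ?_) (fun k => h.lowerCoeff_ne_zero _) (fun k => ?_) key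
    · exact mul_ne_zero (mul_ne_zero hq (hu.ne_zero k)) (hu.nontrivial k)
    · rw [h.lowerCoeff_thirdGen]
      -- Position `k.rev` of the string carries the parameter `m₀ + 2k`. Its factor `q^{2k+1}`
      -- cancels the power of `q` in the subdiagonal entry of the third generator at `k`, and what
      -- remains is the condition on `α`.
      have e : -(m0 + 2 * ((M : ℤ) - 1 - (k.rev : ℕ)) + 1) = -m0 - (2 * (k : ℕ) + 1 : ℕ) := by
        rw [Fin.val_rev]
        have := k.2
        omega
      have ham : alpha_m ≠ 0 := by rintro rfl; simp at halpha_m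
      rw [e, zpow_sub₀ hq, zpow_natCast, pow_succ p.q, pow_mul p.q]
      have hz : p.q ^ (-m0) ≠ 0 := zpow_ne_zero _ hq
      have hz' : (p.q ^ 2) ^ (k : ℕ) ≠ 0 := by positivity
      have hb := hp.b_ne_zero
      have hc := hp.c_ne_zero
      rw [Fin.val_castLE, p.rho_eq]
      generalize p.q ^ (-m0) = z at *
      generalize (p.q ^ 2) ^ (k : ℕ) = y at *
      generalize p.q ^ 2 - 1 / p.q ^ 2 = x at *
      field_simp at halpha_m ⊢
      linear_combination -lowerCoeff v (π (genAs p)) (Fin.castLE hM k) * halpha_m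
  · intro N hN w hw
    have key := h'.prod_thirdGen_apply hN (hw.dual hp)
    simp only [thirdGen_dual hp, spectralValue_dual] at key
    rw [betheState, stringB, map_list_prod, List.map_ofFn]
    simp only [Function.comp_def, dynB_one hp]
    rw [list_ofFn_smul_prod, LinearMap.smul_apply]
    refine eq_prod_inv_smul (l := fun k => lowerCoeff vs (π (genA p)) (k.castLE hN))
      (fun k => ?_) (fun k => h'.lowerCoeff_ne_zero _) (fun k => ?_) key
    · exact mul_ne_zero (mul_ne_zero (neg_ne_zero.2 (inv_ne_zero hq))
        (inv_ne_zero (hw.ne_zero k))) (hw.nontrivial k)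
    · have hl : lowerCoeff vs (thirdGen p.dual (π (genAs p)) (π (genA p))) (k.castLE hN) =
          (p.dual.q ^ 2 - 1 / p.dual.q ^ 2) / (-(p.dual.q ^ 2 - 1 / p.dual.q ^ 2) * p.dual.rho)
          * (p.bs * (p.dual.q ^ 2 - 1 / p.dual.q ^ 2) / (p.q⁻¹ * (p.q⁻¹ ^ 2) ^ (k : ℕ)))
          * (p.dual.q ^ 2 - 1 / p.dual.q ^ 2) * lowerCoeff vs (π (genA p)) (k.castLE hN) :=
        h'.lowerCoeff_thirdGen (k.castLE hN)
      rw [thirdGen_dual hp, Params.dual_rho hp] at hl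
      have hX : p.dual.q ^ 2 - 1 / p.dual.q ^ 2 = -(p.q ^ 2 - 1 / p.q ^ 2) := by
        simp only [Params.dual, inv_pow, one_div, inv_inv]
        ring
      rw [hX] at hl
      refine (congrArg _ hl).trans ?_
      have e : m0 + 2 * ((N : ℤ) - 1 - (k.rev : ℕ)) + 1 = m0 + (2 * (k : ℕ) + 1 : ℕ) := by
        rw [Fin.val_rev]
        have := k.2
        omega
      have ham : alpha_p ≠ 0 := by rintro rfl; simp at halpha_p
      rw [e, zpow_add₀ hq, zpow_natCast, pow_succ p.q, pow_mul p.q, p.rho_eq, hp.bc_eq]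
      have hz : p.q ^ m0 ≠ 0 := zpow_ne_zero _ hq
      have hz' : (p.q ^ 2) ^ (k : ℕ) ≠ 0 := by positivity
      have hb := hp.bs_ne_zero
      have hc := hp.cs_ne_zero
      simp only [inv_pow]
      generalize p.q ^ m0 = z at *
      generalize (p.q ^ 2) ^ (k : ℕ) = y at *
      generalize p.q ^ 2 - 1 / p.q ^ 2 = x at *
      generalize lowerCoeff vs (π (genA p)) (k.castLE hN) = l
      field_simp at halpha_p ⊢
      linear_combination -l * halpha_p
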